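/- **Gaffney-type theorem.** Let $V$ be a countable set and let $\hat\Sigma$ be a simplicial complex on $V$, i.e. a family of finite subsets of $V$ that contains every subset of each of its members, with a weight $m:\hat\Sigma\to(0,\infty)$. Let $\Sigma_0$ be the set of vertices ($v\in V$ with $\{v\}\in\hat\Sigma$), and put $\Sigma=\hat\Sigma$ if $\sum_{v\in\Sigma_0}m(v)<\infty$ and $\Sigma=\hat\Sigma\setminus\{\varnothing\}$ otherwise. Write $\tau\prec\sigma$ (or $\sigma\succ\tau$) if $\tau,\sigma\in\Sigma$, $\tau\subset\sigma$ and $|\sigma\setminus\tau|=1$, and $\dim\tau=|\tau|-1$. Assume that $m$ is locally summable: $\sum_{\sigma\succ\tau}m(\sigma)<\infty$ for all $\tau\in\Sigma$. Let $F=\mathbb R^{\Sigma}$, let $F^c\subseteq F$ be the finitely supported functions, $\ell^2=\ell^2(\Sigma,m)$ the real Hilbert space of $\omega\in F$ with $\sum_\Sigma m\,\omega^2<\infty$, and let $\delta:F\to F$ be a coboundary operator, i.e. a linear map $\delta\omega(\sigma)=\sum_{\tau\prec\sigma}\theta(\tau,\sigma)\omega(\tau)$ with $\theta(\tau,\sigma)=\delta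 1_\tau(\sigma)\in\{-1,0,1\}$, $\theta(\tau,\sigma)\neq0$ iff $\tau\prec\sigma$, and $\delta\delta=0$. Let $\partial$ be the boundary operator with domain $F^1=\{\omega\in F: \sum_{\sigma\succ\tau}m(\sigma)|\omega(\sigma)|<\infty \text{ for all }\tau\in\Sigma\}$ given by $\partial\omega(\rho)=\frac1{m(\rho)}\sum_{\tau\succ\rho}m(\tau)\omega(\tau)\theta(\rho,\tau)$. Let $\mathcal L^+=\partial\delta$, $\mathcal L^-=\delta\partial$, $\mathcal L^H=(\delta+\partial)^2$ on their natural domains in $F$, and let $\Delta^\bullet_c$ be the restriction of $\mathcal L^\bullet$ to $F^c$, $\bullet\in\{+,-,H\}$. Vertices $x\neq x'$ are adjacent, $x\sim x'$, if $\{x,x'\}\in\hat\Sigma$. For $x\sim x'$ define, with $0^{-1/2}=\infty$, $$w^{+}(x,x') = \inf_{\tau\in\Sigma,\ \tau\cap \{x,x'\}\neq\varnothing}\Big(\frac{\dim(\tau)+1}{m(\tau)}\sum_{\sigma\succ\tau}m(\sigma)\Big)^{-1/2},$$ $$w^{-}(x,x') = \inf_{\tau\in\Sigma,\ \tau\cap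 \{x,x'\}\neq\varnothing}\frac12\Big(\sum_{\tau':\ \tau\cap\tau'\prec\tau,\ \tau\cap\tau'\prec\tau'}\frac{m(\tau')}{m(\tau\cap\tau')}\Big)^{-1/2},$$ $$w^H(x,x')=\tfrac1{\sqrt2}\min\{w^+(x,x'),w^-(x,x')\},$$ and let $d^\bullet(v,v')=\inf_{v=v_0\sim\cdots\sim v_n=v'}\sum_{k=0}^{n-1}w^\bullet(v_k,v_{k+1})\in[0,\infty]$ be the corresponding path pseudometric on $\Sigma_0$ (equal to $\infty$ if there is no path from $v$ to $v'$). Let $\bullet\in\{+,-,H\}$. Suppose that all metric balls of $d^\bullet$ in $\Sigma_0$ (of finite radius) are finite, and that $\Sigma$ is locally finite (every nonempty simplex has only finitely many cofaces $\sigma\succ\tau$) or $m$ is balanced ($\sup_{\tau\prec\sigma}m(\sigma)/m(\tau)<\infty$). Then $F^c$ is contained in the domain of $\mathcal L^\bullet$, $\mathcal L^\bullet F^c\subseteq\ell^2$, and the operator $\Delta^\bullet_c$ on $\ell^2$ with domain $F^c$ is essentially self-adjoint, i.e. densely defined and symmetric with self-adjoint closure. -/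

import Mathlib

noncomputable section

open scoped ENNReal

/-- The three types of Laplacians: `+` (up), `-` (down) and `H` (Hodge). -/
inductive LaplacianType
  | up
  | down
  | hodge

/-- A weighted simplicial complex on the vertex set `V`: a family of finite subsets of `V` that is
closed under taking subsets (in particular, the empty simplex belongs to it as soon as the
family is not empty), with a weight that is positive on every simplex.
The values of `m` outside `faces` play no role. -/
structure WeightedComplex (V : Type*) where
  faces : Set (Finset V)
  down_closed : ∀ σ ∈ faces, ∀ τ, τ ⊆ σ → τ ∈ faces
  m : Finset V → ℝ
  m_pos : ∀ σ ∈ faces, 0 < m σ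

/-- A real linear operator with domain is essentially self-adjoint: it is densely defined and
symmetric, and its closure is self-adjoint. -/
def IsEssentiallySelfAdjoint {E : Type*} [NormedAddCommGroup E] [InnerProductSpace ℝ E]
    [CompleteSpace E] (A : E →ₗ.[ℝ] E) : Prop :=
  Dense (A.domain : Set E) ∧ A.IsFormalAdjoint A ∧ IsSelfAdjoint A.closure

/-- The composition `B A` of two operators with domains, on its natural domain
`{x ∈ D(A) | A x ∈ D(B)}`. -/
def LinearPMap.naturalComp {E F G : Type*} [AddCommGroup E] [Module ℝ E] [AddCommGroup F]
    [Module ℝ F] [AddCommGroup G] [Module ℝ G] (B : F →ₗ.[ℝ] G) (A : E →ₗ.[ℝ] F) :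
    E →ₗ.[ℝ] G where
  domain :=
    { carrier := {x | ∃ h : x ∈ A.domain, A ⟨x, h⟩ ∈ B.domain}
      add_mem' := by
        rintro x y ⟨hx, hx'⟩ ⟨hy, hy'⟩
        refine ⟨A.domain.add_mem hx hy, ?_⟩
        have h : A ⟨x + y, A.domain.add_mem hx hy⟩ = A ⟨x, hx⟩ + A ⟨y, hy⟩ :=
          A.map_add ⟨x, hx⟩ ⟨y, hy⟩
        rw [h]
        exact B.domain.add_mem hx' hy'
      zero_mem' := ⟨A.domain.zero_mem, by
        have h : A ⟨0, A.domain.zero_mem⟩ = 0 := A.map_zero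
        rw [h]
        exact B.domain.zero_mem⟩
      smul_mem' := by
        rintro c x ⟨hx, hx'⟩
        refine ⟨A.domain.smul_mem c hx, ?_⟩
        have h : A ⟨c • x, A.domain.smul_mem c hx⟩ = c • A ⟨x, hx⟩ := A.map_smul c ⟨x, hx⟩
        rw [h]
        exact B.domain.smul_mem c hx' }
  toFun :=
    { toFun := fun x => B ⟨A ⟨x.1, x.2.1⟩, x.2.2⟩
      map_add' := by
        intro x y
        rw [← B.map_add]
        congr 1
        exact Subtype.ext (A.map_add ⟨x.1, x.2.1⟩ ⟨y.1, y.2.1⟩)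
      map_smul' := by
        intro c x
        rw [RingHom.id_apply, ← B.map_smul]
        congr 1
        exact Subtype.ext (A.map_smul c ⟨x.1, x.2.1⟩) }

namespace WeightedComplex

variable {V : Type*} (X : WeightedComplex V)

/-- The vertices of the complex (the elements of `Σ₀`). -/
def Vertex : Type _ := {v : V // {v} ∈ X.faces}

/-- The set of simplices `Σ`: the empty simplex is kept if and only if the total weight of the
vertices is finite. -/
def simplices : Set (Finset V) :=
  {σ | σ ∈ X.faces ∧ (σ = ∅ → Summable fun v : X.Vertex => X.m {v.1})}

/-- The type of simplices in `Σ`. -/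
def Simplex : Type _ := {σ : Finset V // σ ∈ X.simplices}

/-- The weight as a function on `Σ`. -/
def wt (σ : X.Simplex) : ℝ := X.m σ.1

variable {X} in
/-- `IsFace τ σ` means `τ ≺ σ`: `τ` is a face of `σ` of codimension one. -/
def IsFace (τ σ : X.Simplex) : Prop := τ.1 ⊆ σ.1 ∧ σ.1.card = τ.1.card + 1

/-- The weight is locally summable: the cofaces of each simplex in `Σ` have finite total weight. -/
def LocallySummable : Prop :=
  ∀ τ : X.Simplex, Summable fun σ : {σ : X.Simplex // IsFace τ σ} => X.wt σ.1

/-- Every nonempty simplex has only finitely many cofaces. -/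
def LocallyFinite : Prop :=
  ∀ τ : X.Simplex, τ.1 ≠ ∅ → {σ : X.Simplex | IsFace τ σ}.Finite

/-- The weight is balanced: `m(σ) / m(τ)` is bounded over all pairs `τ ≺ σ`. -/
def Balanced : Prop :=
  ∃ C : ℝ, ∀ τ σ : X.Simplex, IsFace τ σ → X.wt σ / X.wt τ ≤ C

/-- The characteristic function of the simplex `τ`. -/
def charFn (τ : X.Simplex) : X.Simplex → ℝ := Set.indicator {τ} fun _ => 1

/-- A coboundary operator. The field `apply_eq` says that `δ` is given by the (finite) sum over the
faces, with the signs `θ(τ, σ) = δ 1_τ (σ)`. -/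
structure Coboundary where
  δ : (X.Simplex → ℝ) →ₗ[ℝ] (X.Simplex → ℝ)
  sign : ∀ τ σ, δ (X.charFn τ) σ = -1 ∨ δ (X.charFn τ) σ = 0 ∨ δ (X.charFn τ) σ = 1
  ne_zero_iff : ∀ τ σ, δ (X.charFn τ) σ ≠ 0 ↔ IsFace τ σ
  apply_eq : ∀ ω σ, δ ω σ = ∑ᶠ τ ∈ {τ : X.Simplex | IsFace τ σ}, ω τ * δ (X.charFn τ) σ
  comp_self : ∀ ω, δ (δ ω) = 0

/-- The domain `F¹` of the boundary operator. -/
def F1 : Submodule ℝ (X.Simplex → ℝ) where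
  carrier := {ω | ∀ τ : X.Simplex,
    Summable fun σ : {σ : X.Simplex // IsFace τ σ} => X.wt σ.1 * |ω σ.1|}
  add_mem' := by
    intro f g hf hg τ
    refine Summable.of_norm_bounded ((hf τ).add (hg τ)) fun σ => ?_
    have h0 : 0 < X.wt σ.1 := X.m_pos _ σ.1.2.1
    rw [Real.norm_eq_abs, abs_mul, abs_abs, abs_of_pos h0, ← mul_add]
    exact mul_le_mul_of_nonneg_left (abs_add_le _ _) h0.le
  zero_mem' := by
    intro τ
    simp
  smul_mem' := by
    intro c f hf τ
    refine ((hf τ).mul_left |c|).congr fun σ => ?_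
    simp only [Pi.smul_apply, smul_eq_mul, abs_mul]
    ring

variable {X}

/-- `F1` membership gives summability of the series that defines the boundary operator. -/
lemma Coboundary.summable_boundary (D : X.Coboundary) {ω : X.Simplex → ℝ} (hω : ω ∈ X.F1)
    (ρ : X.Simplex) : Summable fun τ : {τ : X.Simplex // IsFace ρ τ} =>
      X.wt τ.1 * ω τ.1 * D.δ (X.charFn ρ) τ.1 := by
  refine Summable.of_norm_bounded (hω ρ) fun τ => ?_
  have h0 : 0 < X.wt τ.1 := X.m_pos _ τ.1.2.1
  have h1 : |D.δ (X.charFn ρ) τ.1| ≤ 1 := by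
    rcases D.sign ρ τ.1 with h | h | h <;> rw [h] <;> norm_num
  rw [Real.norm_eq_abs, abs_mul, abs_mul, abs_of_pos h0]
  exact mul_le_of_le_one_right (by positivity) h1

/-- The boundary operator `∂ω(ρ) = m(ρ)⁻¹ ∑_{τ ≻ ρ} m(τ) ω(τ) θ(ρ, τ)` with domain `F¹`. -/
def Coboundary.boundary (D : X.Coboundary) : (X.Simplex → ℝ) →ₗ.[ℝ] (X.Simplex → ℝ) where
  domain := X.F1
  toFun :=
    { toFun := fun ω ρ => (X.wt ρ)⁻¹ *
        ∑' τ : {τ : X.Simplex // IsFace ρ τ}, X.wt τ.1 * ω.1 τ.1 * D.δ (X.charFn ρ) τ.1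
      map_add' := by
        intro f g
        funext ρ
        simp only [Pi.add_apply, ← mul_add]
        rw [← (D.summable_boundary f.2 ρ).tsum_add (D.summable_boundary g.2 ρ)]
        congr 1
        refine tsum_congr fun τ => ?_
        simp only [Submodule.coe_add, Pi.add_apply]
        ring
      map_smul' := by
        intro c f
        funext ρ
        simp only [Pi.smul_apply, RingHom.id_apply, smul_eq_mul]
        have h : ∑' τ : {τ : X.Simplex // IsFace ρ τ},
              X.wt τ.1 * (c • f).1 τ.1 * D.δ (X.charFn ρ) τ.1 =
            c * ∑' τ : {τ : X.Simplex // IsFace ρ τ},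
              X.wt τ.1 * f.1 τ.1 * D.δ (X.charFn ρ) τ.1 := by
          rw [← tsum_mul_left]
          refine tsum_congr fun τ => ?_
          simp only [Submodule.coe_smul, Pi.smul_apply, smul_eq_mul]
          ring
        rw [h, mul_left_comm] }

/-- The coboundary operator as an operator with domain all of `F`. -/
def Coboundary.coboundary (D : X.Coboundary) : (X.Simplex → ℝ) →ₗ.[ℝ] (X.Simplex → ℝ) :=
  D.δ.toPMap ⊤

/-- The formal Laplacians `∂δ`, `δ∂` and `(δ + ∂)²` on their natural domains. -/
def Coboundary.formalLaplacian (D : X.Coboundary) :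
    LaplacianType → (X.Simplex → ℝ) →ₗ.[ℝ] (X.Simplex → ℝ)
  | .up => D.boundary.naturalComp D.coboundary
  | .down => D.coboundary.naturalComp D.boundary
  | .hodge => (D.coboundary + D.boundary).naturalComp (D.coboundary + D.boundary)

variable (X)

instance instMeasurableSpaceSimplex : MeasurableSpace X.Simplex := ⊤

/-- The weight as a measure on `Σ`: the point `σ` has mass `m(σ)`. -/
def measure : MeasureTheory.Measure X.Simplex :=
  MeasureTheory.Measure.sum fun σ => ENNReal.ofReal (X.wt σ) • MeasureTheory.Measure.dirac σ

/-- The real Hilbert space `ℓ²(Σ, m)`. -/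
abbrev L2 : Type _ := MeasureTheory.Lp ℝ 2 X.measure

variable {X}

/-- All points have positive mass, so an element of `ℓ²(Σ, m)` is an honest function. -/
lemma eq_of_ae_eq {f g : X.Simplex → ℝ} (h : f =ᵐ[X.measure] g) : f = g := by
  funext σ
  by_contra hne
  have h1 : X.measure {σ} = 0 :=
    MeasureTheory.measure_mono_null (Set.singleton_subset_iff.2 hne) (MeasureTheory.ae_iff.1 h)
  have h2 := MeasureTheory.Measure.le_sum_apply
    (fun σ : X.Simplex => ENNReal.ofReal (X.wt σ) • MeasureTheory.Measure.dirac σ) {σ}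
  have h3 : X.measure {σ} = MeasureTheory.Measure.sum
    (fun σ : X.Simplex => ENNReal.ofReal (X.wt σ) • MeasureTheory.Measure.dirac σ) {σ} := rfl
  rw [← h3, h1] at h2
  have h4 : ∑' τ : X.Simplex,
      (ENNReal.ofReal (X.wt τ) • MeasureTheory.Measure.dirac τ) {σ} = 0 := le_antisymm h2 zero_le
  have h5 := ENNReal.tsum_eq_zero.1 h4 σ
  have h0 : 0 < X.wt σ := X.m_pos _ σ.2.1
  simp [not_le.2 h0] at h5

lemma L2.coe_add (f g : X.L2) : (⇑(f + g) : X.Simplex → ℝ) = ⇑f + ⇑g :=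
  eq_of_ae_eq (MeasureTheory.Lp.coeFn_add f g)

lemma L2.coe_smul (c : ℝ) (f : X.L2) : (⇑(c • f) : X.Simplex → ℝ) = c • ⇑f :=
  eq_of_ae_eq (MeasureTheory.Lp.coeFn_smul c f)

variable (X)

/-- The space `Fᶜ` of finitely supported functions, as a subspace of `ℓ²(Σ, m)`. -/
def Fc : Submodule ℝ X.L2 where
  carrier := {f | (Function.support f).Finite}
  add_mem' := by
    intro f g hf hg
    rw [Set.mem_ofPred_eq, L2.coe_add]
    exact (hf.union hg).subset (Function.support_add _ _)
  zero_mem' := by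
    have h : (⇑(0 : X.L2) : X.Simplex → ℝ) = 0 := eq_of_ae_eq (MeasureTheory.Lp.coeFn_zero _ _ _)
    rw [Set.mem_ofPred_eq, h]
    simp
  smul_mem' := by
    intro c f hf
    rw [Set.mem_ofPred_eq, L2.coe_smul]
    exact hf.subset (Function.support_const_smul_subset c _)

variable {X}

/-- The formal Laplacian maps finitely supported functions into `ℓ²(Σ, m)`: every finitely
supported function belongs to its domain and has a square summable image. -/
def Coboundary.MapsFcToL2 (D : X.Coboundary) (t : LaplacianType) : Prop :=
  ∀ f : X.Simplex → ℝ, (Function.support f).Finite →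
    ∃ hf : f ∈ (D.formalLaplacian t).domain,
      MeasureTheory.MemLp (D.formalLaplacian t ⟨f, hf⟩) 2 X.measure

/-- The operator `Δ_c` on `ℓ²(Σ, m)`: the restriction of the formal Laplacian to `Fᶜ`. -/
def Coboundary.laplacianC (D : X.Coboundary) (t : LaplacianType) (h : D.MapsFcToL2 t) :
    X.L2 →ₗ.[ℝ] X.L2 where
  domain := X.Fc
  toFun :=
    { toFun := fun f => (h f.1 f.2).2.toLp _
      map_add' := by
        intro f g
        rw [← MeasureTheory.MemLp.toLp_add]
        congr 1
        rw [← LinearPMap.map_add]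
        congr 1
        exact Subtype.ext (L2.coe_add f.1 g.1)
      map_smul' := by
        intro c f
        rw [RingHom.id_apply, ← MeasureTheory.MemLp.toLp_const_smul]
        congr 1
        rw [← LinearPMap.map_smul]
        congr 1
        exact Subtype.ext (L2.coe_smul c f.1) }

variable (X)

/-- The 1-skeleton as a graph: distinct vertices are adjacent if they span a 1-simplex. -/
def skeleton : SimpleGraph X.Vertex where
  Adj v w := v ≠ w ∧ ∃ e ∈ X.faces, e.card = 2 ∧ v.1 ∈ e ∧ w.1 ∈ e
  symm := ⟨fun _ _ ⟨h, e, he, h2, hv, hw⟩ => ⟨h.symm, e, he, h2, hw, hv⟩⟩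
  loopless := ⟨fun _ h => h.1 rfl⟩

/-- The quantity `(dim τ + 1) / m(τ) * ∑_{σ ≻ τ} m(σ)`. -/
def upSum (τ : X.Simplex) : ℝ≥0∞ :=
  τ.1.card / ENNReal.ofReal (X.wt τ) *
    ∑' σ : {σ : X.Simplex // IsFace τ σ}, ENNReal.ofReal (X.wt σ.1)

/-- The quantity `∑ m(τ') / m(τ ∩ τ')` over all `τ' ≠ τ` such that `τ ∩ τ'` is a common face of
`τ` and `τ'` (the pairs `(ρ, τ')` below are exactly the pairs `(τ ∩ τ', τ')`). -/
def downSum (τ : X.Simplex) : ℝ≥0∞ :=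
  ∑' p : {p : X.Simplex × X.Simplex //
      (∀ v, v ∈ p.1.1 ↔ v ∈ τ.1 ∧ v ∈ p.2.1) ∧ IsFace p.1 τ ∧ IsFace p.1 p.2},
    ENNReal.ofReal (X.wt p.1.2) / ENNReal.ofReal (X.wt p.1.1)

/-- The edge weight `w⁺`, with values in `[0, ∞]` and `0 ^ (-1/2) = ∞`. The infimum is over all
simplices that contain `x` or `y`. -/
def upWeight (x y : X.Vertex) : ℝ≥0∞ :=
  ⨅ τ : {τ : X.Simplex // x.1 ∈ τ.1 ∨ y.1 ∈ τ.1}, X.upSum τ.1 ^ (-(1 / 2) : ℝ)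

/-- The edge weight `w⁻`, with values in `[0, ∞]` and `0 ^ (-1/2) = ∞`. -/
def downWeight (x y : X.Vertex) : ℝ≥0∞ :=
  ⨅ τ : {τ : X.Simplex // x.1 ∈ τ.1 ∨ y.1 ∈ τ.1}, 2⁻¹ * X.downSum τ.1 ^ (-(1 / 2) : ℝ)

/-- The edge weights `w⁺`, `w⁻` and `w^H = min (w⁺, w⁻) / √2` of adjacent vertices. -/
def edgeWeight : LaplacianType → X.Vertex → X.Vertex → ℝ≥0∞
  | .up, x, y => X.upWeight x y
  | .down, x, y => X.downWeight x y
  | .hodge, x, y => min (X.upWeight x y) (X.downWeight x y) / ENNReal.ofReal (Real.sqrt 2)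

/-- The path pseudometric on the vertices: the infimum of the lengths of all walks in the
1-skeleton. It is `∞` if there is no walk. -/
def pathDist (t : LaplacianType) (v w : X.Vertex) : ℝ≥0∞ :=
  ⨅ p : X.skeleton.Walk v w, (p.darts.map fun e => X.edgeWeight t e.fst e.snd).sum

/-- All metric balls of the path pseudometric are finite. -/
def FiniteBalls (t : LaplacianType) : Prop :=
  ∀ (v : X.Vertex) (r : ℝ), {w : X.Vertex | X.pathDist t v w ≤ ENNReal.ofReal r}.Finite

end WeightedComplex

end

section

open Filter Topology MeasureTheory
open scoped ENNReal InnerProductSpace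

/-! `Δ_c` is densely defined, symmetric and nonnegative, so by `isEssentiallySelfAdjoint_of_nonneg`
it suffices that every `u` in ℓ² orthogonal to the range of `Δ_c + 1` vanishes. Tested against
characteristic functions, such a `u` solves `(K + m) u = 0` pointwise, where `K(ρ, τ) = ⟨Δ 1_τ,
1_ρ⟩` is a Gram kernel and hence positive semidefinite. Multiply by `η² u` for a finitely supported
cutoff `η` and sum. If `∑_ρ |K(ρ, τ)| (η(ρ) - η(τ))² ≤ ε m(τ)`, the energy term is at least `-(ε /
2) ‖u‖²` (`sum_kernel_cutoff`). Letting `ε → 0` while `η` is 1 on growing finite sets gives `u = 0`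
(`eq_zero_of_cutoff`).

The cutoffs come from the path pseudometric. Take `φ = (1 - d / R)₊` on the vertices, with `d` the
distance to a finite set, and `η(τ) = ∏_{v ∈ τ} φ(v)`. Finite balls make `φ` and `η` finitely
supported. Distinct simplices coupled through a common coface or a common nonempty face differ by
exchanging one vertex, and these two vertices are joined by one or two edges touching `τ`. So `η`
changes by at most the corresponding edge lengths over `R`, and `w⁺`, `w⁻` are exactly what turns
this into the required bound, with `ε` of order `R⁻²` (`FiniteBalls.exists_cutoff`).

The empty simplex needs separate treatment: through it `δ∂` couples all vertices, adjacent or not,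
so `η` need not vary slowly there. This part of the kernel is of rank one, given by a vector that is
square summable with respect to `1/m` (`downKernel_eq`, `summable_emptyVec`), and in the limit its
contribution is a nonnegative square. Finite balls also force each vertex to lie in finitely many
simplices (`FiniteBalls.finite_cofaces`). Hence the remaining kernel has finite rows, and `Δ` maps
finitely supported functions into ℓ². -/

/-! ### An abstract criterion for essential self-adjointness -/

/-- A nonnegative symmetric densely defined operator `A` such that the range of `A + 1` is dense is
essentially self-adjoint. -/
theorem isEssentiallySelfAdjoint_of_nonneg {E : Type*} [NormedAddCommGroup E]
    [InnerProductSpace ℝ E] [CompleteSpace E] {A : E →ₗ.[ℝ] E} (hd : Dense (A.domain : Set E))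
    (hs : A.IsFormalAdjoint A) (hnn : ∀ f : A.domain, 0 ≤ ⟪A f, (f : E)⟫_ℝ)
    (hr : ∀ u : E, (∀ f : A.domain, ⟪u, A f + f⟫_ℝ = 0) → u = 0) :
    IsEssentiallySelfAdjoint A := by
  refine ⟨hd, hs, ?_⟩
  have hclosable : A.IsClosable :=
    (LinearPMap.adjoint_isClosed hd).isClosable.leIsClosable (hs.le_adjoint hd)
  have hgraph : ∀ p : E × E, p ∈ A.closure.graph ↔ p ∈ closure (A.graph : Set (E × E)) := by
    intro p
    rw [← hclosable.graph_closure_eq_closure_graph, ← SetLike.mem_coe,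
      Submodule.topologicalClosure_coe]
  have hBd : Dense (A.closure.domain : Set E) := hd.mono A.le_closure.1
  have key1 : ∀ p ∈ A.closure.graph, ∀ f : A.domain, ⟪p.2, (f : E)⟫_ℝ = ⟪p.1, A f⟫_ℝ := by
    intro p hp f
    have hcl : IsClosed {p : E × E | ⟪p.2, (f : E)⟫_ℝ = ⟪p.1, A f⟫_ℝ} :=
      isClosed_eq (by fun_prop) (by fun_prop)
    refine closure_minimal ?_ hcl ((hgraph p).1 hp)
    rintro ⟨x, y⟩ hxy
    obtain ⟨z, rfl, rfl⟩ := (LinearPMap.mem_graph_iff A).1 hxy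
    exact hs z f
  have key2 : ∀ p ∈ A.closure.graph, ∀ q ∈ A.closure.graph, ⟪p.2, q.1⟫_ℝ = ⟪p.1, q.2⟫_ℝ := by
    intro p hp q hq
    have hcl : IsClosed {q : E × E | ⟪p.2, q.1⟫_ℝ = ⟪p.1, q.2⟫_ℝ} :=
      isClosed_eq (by fun_prop) (by fun_prop)
    refine closure_minimal ?_ hcl ((hgraph q).1 hq)
    rintro ⟨x, y⟩ hxy
    obtain ⟨z, rfl, rfl⟩ := (LinearPMap.mem_graph_iff A).1 hxy
    exact key1 p hp z
  have hle : A.closure ≤ A.closure.adjoint := by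
    refine LinearPMap.IsFormalAdjoint.le_adjoint hBd fun x y => ?_
    exact key2 _ (A.closure.mem_graph x) _ (A.closure.mem_graph y)
  refine le_antisymm (LinearPMap.le_of_le_graph ?_) hle
  rintro ⟨u, w⟩ huw
  obtain ⟨u, rfl, rfl⟩ := (LinearPMap.mem_graph_iff _).1 huw
  set w := A.closure.adjoint u with hw
  have hu : ∀ f : A.domain, ⟪w, (f : E)⟫_ℝ = ⟪(u : E), A f⟫_ℝ := by
    intro f
    have h1 := LinearPMap.adjoint_isFormalAdjoint hBd u ⟨f, A.le_closure.1 f.2⟩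
    have h2 : A.closure ⟨f, A.le_closure.1 f.2⟩ = A f := (A.le_closure.2 rfl).symm
    rw [h2] at h1
    exact h1
  let T : A.domain →ₗ[ℝ] E := A.toFun + A.domain.subtype
  have hT : ∀ f, T f = A f + f := fun f => rfl
  have hbound : ∀ f : A.domain, ‖(f : E)‖ ≤ ‖T f‖ := by
    intro f
    have h1 : ‖(f : E)‖ * ‖(f : E)‖ ≤ ‖T f‖ * ‖(f : E)‖ := by
      calc ‖(f : E)‖ * ‖(f : E)‖ = ⟪(f : E), (f : E)⟫_ℝ := (real_inner_self_eq_norm_mul_norm _).symm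
        _ ≤ ⟪T f, (f : E)⟫_ℝ := by rw [hT, inner_add_left]; linarith [hnn f]
        _ ≤ ‖T f‖ * ‖(f : E)‖ := real_inner_le_norm _ _
    rcases (norm_nonneg (f : E)).eq_or_lt with h | h
    · rw [← h]; exact norm_nonneg _
    · exact le_of_mul_le_mul_right h1 h
  have hrange : Dense (LinearMap.range T : Set E) := by
    rw [Submodule.dense_iff_topologicalClosure_eq_top, Submodule.topologicalClosure_eq_top_iff,
      Submodule.eq_bot_iff]
    intro x hx
    refine hr x fun f => ?_
    rw [← hT, real_inner_comm]
    exact (Submodule.mem_orthogonal _ _).1 hx _ ⟨f, rfl⟩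
  -- With `B` the closure of `A` and `w = B* u`, solve `(B + 1) g = u + w`: approximate the right
  -- side from the range of `A + 1`. Since `A + 1` is bounded below by 1, the preimages converge.
  obtain ⟨s, hs1, hs2⟩ := mem_closure_iff_seq_limit.1 (hrange ((u : E) + w))
  choose f hf using hs1
  have hcauchy : CauchySeq fun n => (f n : E) := by
    have h1 := hs2.cauchySeq
    rw [Metric.cauchySeq_iff] at h1 ⊢
    intro ε hε
    obtain ⟨N, hN⟩ := h1 ε hε
    refine ⟨N, fun m hm n hn => lt_of_le_of_lt ?_ (hN m hm n hn)⟩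
    rw [dist_eq_norm, dist_eq_norm, ← hf m, ← hf n, ← map_sub]
    exact hbound (f m - f n)
  obtain ⟨g, hg⟩ := cauchySeq_tendsto_of_complete hcauchy
  have hAf : Tendsto (fun n => A (f n)) atTop (𝓝 ((u : E) + w - g)) := by
    refine (hs2.sub hg).congr fun n => ?_
    rw [← hf n, hT, add_sub_cancel_right]
  have hmem : (g, (u : E) + w - g) ∈ A.closure.graph := by
    rw [hgraph]
    exact mem_closure_of_tendsto (hg.prodMk_nhds hAf)
      (Eventually.of_forall fun n => A.mem_graph (f n))
  -- Both `u` and `g` satisfy the weak equation with right side `u + w`, so `u - g` is orthogonal to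
  -- the range of `A + 1`.
  have hug : (u : E) - g = 0 := by
    refine hr _ fun f => ?_
    have h1 := key1 _ hmem f
    have h2 := hu f
    simp only [inner_sub_left, inner_add_left, inner_add_right] at h1 ⊢
    linarith
  have hg' : g = u := (sub_eq_zero.1 hug).symm
  rw [hg', add_sub_cancel_left] at hmem
  exact hmem

/-! ### ℓ² and its finitely supported elements as functions -/

namespace WeightedComplex

variable {V : Type*} {X : WeightedComplex V}

lemma wt_pos (σ : X.Simplex) : 0 < X.wt σ := X.m_pos _ σ.2.1

lemma lintegral_measure (f : X.Simplex → ℝ≥0∞) :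
    ∫⁻ σ, f σ ∂X.measure = ∑' σ, ENNReal.ofReal (X.wt σ) * f σ := by
  rw [measure, lintegral_sum_measure]
  refine tsum_congr fun σ => ?_
  rw [lintegral_smul_measure, lintegral_dirac' _ measurable_from_top, smul_eq_mul]

lemma aestronglyMeasurable (f : X.Simplex → ℝ) : AEStronglyMeasurable f X.measure :=
  (measurable_from_top (f := f)).aestronglyMeasurable

lemma integrable_iff_summable {f : X.Simplex → ℝ} :
    Integrable f X.measure ↔ Summable fun σ => X.wt σ * |f σ| := by
  have h : ∀ σ, ENNReal.ofReal (X.wt σ) * ‖f σ‖ₑ = ENNReal.ofReal (X.wt σ * |f σ|) := fun σ => by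
    rw [ENNReal.ofReal_mul (wt_pos σ).le, Real.enorm_eq_ofReal_abs]
  have hnn : ∀ σ, 0 ≤ X.wt σ * |f σ| := fun σ => mul_nonneg (wt_pos σ).le (abs_nonneg _)
  rw [Integrable, and_iff_right (aestronglyMeasurable f), HasFiniteIntegral, lintegral_measure]
  simp only [h]
  constructor
  · intro h1
    refine (ENNReal.summable_toReal h1.ne).congr fun σ => ?_
    rw [ENNReal.toReal_ofReal (hnn σ)]
  · intro h1
    rw [← ENNReal.ofReal_tsum_of_nonneg hnn h1]
    exact ENNReal.ofReal_lt_top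

lemma memLp_two_iff_summable {f : X.Simplex → ℝ} :
    MemLp f 2 X.measure ↔ Summable fun σ => X.wt σ * f σ ^ 2 := by
  rw [memLp_two_iff_integrable_sq (aestronglyMeasurable f), integrable_iff_summable]
  simp only [abs_sq]

lemma integral_measure {f : X.Simplex → ℝ} (hf : Integrable f X.measure) :
    ∫ σ, f σ ∂X.measure = ∑' σ, X.wt σ * f σ := by
  rw [measure] at hf ⊢
  rw [integral_sum_measure hf]
  refine tsum_congr fun σ => ?_
  rw [integral_smul_measure, integral_dirac' _ _ (measurable_from_top (f := f)).stronglyMeasurable,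
    ENNReal.toReal_ofReal (wt_pos σ).le, smul_eq_mul]

lemma coe_toLp {f : X.Simplex → ℝ} (hf : MemLp f 2 X.measure) :
    (⇑(hf.toLp f) : X.Simplex → ℝ) = f :=
  eq_of_ae_eq hf.coeFn_toLp

lemma L2.summable_sq (u : X.L2) : Summable fun σ => X.wt σ * u σ ^ 2 :=
  memLp_two_iff_summable.1 (Lp.memLp u)

lemma L2.summable_mul (u v : X.L2) : Summable fun σ => X.wt σ * (u σ * v σ) := by
  refine Summable.of_norm_bounded ((u.summable_sq).add (v.summable_sq)) fun σ => ?_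
  rw [Real.norm_eq_abs, abs_mul, abs_of_pos (wt_pos σ), ← mul_add]
  refine mul_le_mul_of_nonneg_left ?_ (wt_pos σ).le
  rw [abs_le]
  constructor <;> nlinarith [sq_nonneg (u σ + v σ), sq_nonneg (u σ - v σ), sq_nonneg (u σ)]

lemma L2.inner_eq_tsum (u v : X.L2) : ⟪u, v⟫_ℝ = ∑' σ, X.wt σ * (u σ * v σ) := by
  rw [MeasureTheory.L2.inner_def]
  have h : ∀ σ, ⟪u σ, v σ⟫_ℝ = u σ * v σ := fun σ => by simp [mul_comm]
  simp only [h]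
  refine integral_measure (integrable_iff_summable.2 ?_)
  refine (u.summable_mul v).abs.congr fun σ => ?_
  rw [abs_mul, abs_of_pos (wt_pos σ)]

lemma charFn_self (τ : X.Simplex) : X.charFn τ τ = 1 := by simp [charFn]

lemma charFn_of_ne {τ σ : X.Simplex} (h : σ ≠ τ) : X.charFn τ σ = 0 := by simp [charFn, h]

lemma finite_support_charFn (τ : X.Simplex) : (Function.support (X.charFn τ)).Finite :=
  (Set.finite_singleton τ).subset fun σ hσ => by
    by_contra h
    exact hσ (charFn_of_ne h)

lemma memLp_of_finite_support {f : X.Simplex → ℝ} (hf : (Function.support f).Finite) :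
    MemLp f 2 X.measure := by
  refine memLp_two_iff_summable.2 (summable_of_hasFiniteSupport (hf.subset fun σ hσ => ?_))
  intro h
  exact hσ (by simp [h])

/-- A finitely supported function as an element of `Fᶜ`. -/
noncomputable def toFc (f : X.Simplex → ℝ) (hf : (Function.support f).Finite) : X.Fc :=
  ⟨(memLp_of_finite_support hf).toLp f, by
    change (Function.support _).Finite
    rwa [coe_toLp]⟩

lemma coe_toFc (f : X.Simplex → ℝ) (hf : (Function.support f).Finite) :
    (⇑(toFc f hf).1 : X.Simplex → ℝ) = f :=
  coe_toLp (memLp_of_finite_support hf)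

lemma inner_toFc_charFn (u : X.L2) (τ : X.Simplex) :
    ⟪u, ((toFc (X.charFn τ) (finite_support_charFn τ)).1 : X.L2)⟫_ℝ = X.wt τ * u τ := by
  rw [L2.inner_eq_tsum, coe_toFc, tsum_eq_single τ, charFn_self, mul_one]
  intro σ hσ
  rw [charFn_of_ne hσ, mul_zero, mul_zero]

lemma L2.ext_fun {u v : X.L2} (h : ∀ σ, u σ = v σ) : u = v :=
  Lp.ext (Eventually.of_forall h)

lemma dense_Fc : Dense (X.Fc : Set X.L2) := by
  rw [Submodule.dense_iff_topologicalClosure_eq_top, Submodule.topologicalClosure_eq_top_iff,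
    Submodule.eq_bot_iff]
  intro u hu
  refine L2.ext_fun fun τ => ?_
  have h1 := (Submodule.mem_orthogonal' _ _).1 hu _
    (toFc (X.charFn τ) (finite_support_charFn τ)).2
  rw [inner_toFc_charFn] at h1
  have h0 : (⇑(0 : X.L2) : X.Simplex → ℝ) = 0 := eq_of_ae_eq (Lp.coeFn_zero _ _ _)
  rw [h0]
  exact (mul_eq_zero.1 h1).resolve_left (wt_pos τ).ne'

lemma eq_sum_charFn {f : X.Simplex → ℝ} {T : Finset X.Simplex} (hT : Function.support f ⊆ T) :
    f = ∑ τ ∈ T, f τ • X.charFn τ := by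
  funext σ
  rw [Finset.sum_apply]
  by_cases hσ : σ ∈ T
  · rw [Finset.sum_eq_single_of_mem σ hσ]
    · simp [charFn_self]
    · intro τ _ h
      simp [charFn_of_ne h.symm]
  · rw [Finset.sum_eq_zero]
    · by_contra h
      exact hσ (hT h)
    · intro τ hτ
      rw [Pi.smul_apply, charFn_of_ne, smul_zero]
      rintro rfl
      exact hσ hτ

end WeightedComplex

/-! ### The Laplacians on characteristic functions and their kernels -/

/-- The coefficient of `∂δ` in the Laplacian. -/
def LaplacianType.upCoeff : LaplacianType → ℝ
  | .up => 1
  | .down => 0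
  | .hodge => 1

/-- The coefficient of `δ∂` in the Laplacian. -/
def LaplacianType.downCoeff : LaplacianType → ℝ
  | .up => 0
  | .down => 1
  | .hodge => 1

namespace WeightedComplex

variable {V : Type*} {X : WeightedComplex V}

lemma IsFace.ne {τ σ : X.Simplex} (h : IsFace τ σ) : τ ≠ σ := by
  rintro rfl
  exact absurd h.2 (by omega)

lemma IsFace.nonempty {τ σ : X.Simplex} (h : IsFace τ σ) : σ.1.Nonempty :=
  Finset.card_pos.1 (by have := h.2; omega)

lemma finite_subsets (σ : X.Simplex) : {τ : X.Simplex | τ.1 ⊆ σ.1}.Finite := by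
  refine Set.Finite.of_finite_image (f := Subtype.val) ?_ Subtype.val_injective.injOn
  refine (σ.1.powerset.finite_toSet).subset ?_
  rintro _ ⟨τ, hτ, rfl⟩
  exact Finset.mem_coe.2 (Finset.mem_powerset.2 hτ)

lemma finite_faces (σ : X.Simplex) : {τ : X.Simplex | IsFace τ σ}.Finite :=
  (finite_subsets σ).subset fun _ h => h.1

lemma mem_F1_of_bounded (hsum : X.LocallySummable) {f : X.Simplex → ℝ} {C : ℝ}
    (hf : ∀ σ, |f σ| ≤ C) : f ∈ X.F1 := by
  intro τ
  refine Summable.of_nonneg_of_le (fun σ => mul_nonneg (wt_pos _).le (abs_nonneg _)) (fun σ => ?_)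
    ((hsum τ).mul_right C)
  exact mul_le_mul_of_nonneg_left (hf σ.1) (wt_pos _).le

namespace Coboundary

variable (D : X.Coboundary)

/-- The sign `θ(τ, σ)`. -/
noncomputable def sgn (τ σ : X.Simplex) : ℝ := D.δ (X.charFn τ) σ

lemma abs_sgn_le (τ σ : X.Simplex) : |D.sgn τ σ| ≤ 1 := by
  rcases D.sign τ σ with h | h | h <;> rw [sgn, h] <;> norm_num

variable {D} in
lemma isFace_of_sgn_ne_zero {τ σ : X.Simplex} (h : D.sgn τ σ ≠ 0) : IsFace τ σ :=
  (D.ne_zero_iff τ σ).1 h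

lemma sgn_eq_zero {τ σ : X.Simplex} (h : ¬ IsFace τ σ) : D.sgn τ σ = 0 := by
  by_contra h1
  exact h (isFace_of_sgn_ne_zero h1)

lemma summable_wt_sgn (hsum : X.LocallySummable) (τ : X.Simplex) :
    Summable fun σ => X.wt σ * |D.sgn τ σ| := by
  have h1 : Summable fun σ => Set.indicator {σ : X.Simplex | IsFace τ σ} X.wt σ :=
    summable_subtype_iff_indicator.1 (hsum τ)
  refine Summable.of_nonneg_of_le (fun σ => mul_nonneg (wt_pos _).le (abs_nonneg _)) (fun σ => ?_) h1
  by_cases h : IsFace τ σ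
  · rw [Set.indicator_of_mem (Set.mem_ofPred.2 h)]
    exact mul_le_of_le_one_right (wt_pos σ).le (D.abs_sgn_le τ σ)
  · rw [D.sgn_eq_zero h, abs_zero, mul_zero, Set.indicator_of_notMem (by simpa using h)]

lemma boundary_apply {f : X.Simplex → ℝ} (hf : f ∈ X.F1) (ρ : X.Simplex) :
    D.boundary ⟨f, hf⟩ ρ = (X.wt ρ)⁻¹ * ∑' τ, X.wt τ * f τ * D.sgn ρ τ := by
  change (X.wt ρ)⁻¹ * _ = _
  congr 1
  refine tsum_subtype_eq_of_support_subset (s := {τ | IsFace ρ τ})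
    (f := fun τ => X.wt τ * f τ * D.sgn ρ τ) fun τ hτ => ?_
  by_contra h
  exact hτ (by simp only [D.sgn_eq_zero h, mul_zero])

lemma delta_apply (f : X.Simplex → ℝ) (σ : X.Simplex) :
    D.δ f σ = ∑' τ, f τ * D.sgn τ σ := by
  have h : (Function.support fun τ => f τ * D.sgn τ σ) ⊆ {τ : X.Simplex | IsFace τ σ} := fun τ hτ =>
    isFace_of_sgn_ne_zero (right_ne_zero_of_mul hτ)
  rw [D.apply_eq, tsum_eq_finsum ((finite_faces σ).subset h)]
  refine finsum_congr fun τ => ?_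
  by_cases h : IsFace τ σ
  · simp [h, sgn]
  · simp [h, D.sgn_eq_zero h]

lemma charFn_mem_F1 (hsum : X.LocallySummable) (τ : X.Simplex) : X.charFn τ ∈ X.F1 := by
  refine mem_F1_of_bounded (C := 1) hsum fun σ => ?_
  by_cases h : σ = τ
  · rw [h, charFn_self]; simp
  · rw [charFn_of_ne h]; simp

lemma delta_charFn_mem_F1 (hsum : X.LocallySummable) (τ : X.Simplex) :
    D.δ (X.charFn τ) ∈ X.F1 :=
  mem_F1_of_bounded hsum (D.abs_sgn_le τ)

lemma boundary_charFn (hsum : X.LocallySummable) (τ κ : X.Simplex) :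
    D.boundary ⟨X.charFn τ, charFn_mem_F1 hsum τ⟩ κ = (X.wt κ)⁻¹ * (X.wt τ * D.sgn κ τ) := by
  rw [boundary_apply, tsum_eq_single τ, charFn_self, mul_one]
  intro σ hσ
  rw [charFn_of_ne hσ, mul_zero, zero_mul]

/-- The boundary of `1_τ` lives on the finitely many faces of `τ`, so it is bounded, and local
summability applies. -/
lemma boundary_charFn_mem_F1 (hsum : X.LocallySummable) (τ : X.Simplex) :
    D.boundary ⟨X.charFn τ, charFn_mem_F1 hsum τ⟩ ∈ X.F1 := by
  refine mem_F1_of_bounded (C := ∑ κ ∈ (finite_faces τ).toFinset, (X.wt κ)⁻¹ * X.wt τ) hsum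
    fun κ => ?_
  have hnn : ∀ κ, 0 ≤ (X.wt κ)⁻¹ * X.wt τ := fun κ =>
    mul_nonneg (inv_nonneg.2 (wt_pos κ).le) (wt_pos τ).le
  rw [boundary_charFn D hsum]
  by_cases h : IsFace κ τ
  · refine le_trans ?_ (Finset.single_le_sum (f := fun κ => (X.wt κ)⁻¹ * X.wt τ)
      (fun κ _ => hnn κ) ((finite_faces τ).mem_toFinset.2 h))
    rw [← mul_assoc, abs_mul, abs_of_nonneg (hnn κ)]
    exact mul_le_of_le_one_right (hnn κ) (D.abs_sgn_le κ τ)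
  · rw [D.sgn_eq_zero h, mul_zero, mul_zero, abs_zero]
    exact Finset.sum_nonneg fun κ _ => hnn κ

/-- The kernel `∑_σ m(σ) θ(ρ, σ) θ(τ, σ)` of the Laplacian `∂δ` with respect to `m`. -/
noncomputable def upKernel (ρ τ : X.Simplex) : ℝ :=
  ∑' σ, X.wt σ * (D.sgn ρ σ * D.sgn τ σ)

/-- The kernel of the Laplacian `δ∂` with respect to `m`. -/
noncomputable def downKernel (ρ τ : X.Simplex) : ℝ :=
  ∑' κ, (X.wt κ)⁻¹ * ((X.wt ρ * D.sgn κ ρ) * (X.wt τ * D.sgn κ τ))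

lemma boundary_delta_charFn (hsum : X.LocallySummable) (τ ρ : X.Simplex) :
    D.boundary ⟨D.δ (X.charFn τ), D.delta_charFn_mem_F1 hsum τ⟩ ρ =
      (X.wt ρ)⁻¹ * D.upKernel ρ τ := by
  rw [boundary_apply, upKernel]
  congr 1
  refine tsum_congr fun σ => ?_
  change _ * D.sgn τ σ * _ = _
  ring

lemma delta_boundary_charFn (hsum : X.LocallySummable) (τ ρ : X.Simplex) :
    D.δ (D.boundary ⟨X.charFn τ, charFn_mem_F1 hsum τ⟩) ρ =
      (X.wt ρ)⁻¹ * D.downKernel ρ τ := by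
  rw [delta_apply, downKernel, ← tsum_mul_left]
  refine tsum_congr fun κ => ?_
  rw [boundary_charFn D hsum]
  have h1 := (wt_pos ρ).ne'
  field_simp

/-- By formal adjointness of `δ` and `∂`, the value is `m(σ) / m(ρ)` times `δδ1_ρ(σ)`. Together with
`δδ = 0` this removes the off-diagonal terms of `(δ + ∂)²`. -/
lemma boundary_boundary_charFn (hsum : X.LocallySummable) (σ ρ : X.Simplex) :
    D.boundary ⟨_, D.boundary_charFn_mem_F1 hsum σ⟩ ρ = 0 := by
  have h1 : D.δ (D.δ (X.charFn ρ)) σ = 0 := by rw [D.comp_self]; rfl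
  rw [delta_apply] at h1
  have h2 : ∀ τ, X.wt τ * D.boundary ⟨X.charFn σ, charFn_mem_F1 hsum σ⟩ τ * D.sgn ρ τ =
      X.wt σ * (D.δ (X.charFn ρ) τ * D.sgn τ σ) := by
    intro τ
    rw [boundary_charFn D hsum]
    change _ = X.wt σ * (D.sgn ρ τ * D.sgn τ σ)
    have h1 := (wt_pos τ).ne'
    field_simp
  rw [boundary_apply]
  simp only [h2]
  rw [tsum_mul_left, h1, mul_zero, mul_zero]

variable (t : LaplacianType)

/-- The kernel of the Laplacian of type `t` with respect to `m`. -/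
noncomputable def kernel (ρ τ : X.Simplex) : ℝ :=
  t.upCoeff * D.upKernel ρ τ + t.downCoeff * D.downKernel ρ τ

lemma formalLaplacian_charFn (hsum : X.LocallySummable) (τ : X.Simplex) :
    ∃ hf : X.charFn τ ∈ (D.formalLaplacian t).domain, ∀ ρ,
      D.formalLaplacian t ⟨X.charFn τ, hf⟩ ρ = (X.wt ρ)⁻¹ * D.kernel t ρ τ := by
  cases t with
  | up =>
    refine ⟨⟨trivial, D.delta_charFn_mem_F1 hsum τ⟩, fun ρ => ?_⟩
    refine (D.boundary_delta_charFn hsum τ ρ).trans ?_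
    simp [kernel, LaplacianType.upCoeff, LaplacianType.downCoeff]
  | down =>
    refine ⟨⟨charFn_mem_F1 hsum τ, trivial⟩, fun ρ => ?_⟩
    refine (D.delta_boundary_charFn hsum τ ρ).trans ?_
    simp [kernel, LaplacianType.upCoeff, LaplacianType.downCoeff]
  | hodge =>
    have hdom : X.charFn τ ∈ (D.coboundary + D.boundary).domain :=
      ⟨trivial, charFn_mem_F1 hsum τ⟩
    have hval : (D.coboundary + D.boundary) ⟨X.charFn τ, hdom⟩ =
        D.δ (X.charFn τ) + D.boundary ⟨X.charFn τ, charFn_mem_F1 hsum τ⟩ := rfl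
    have hdom2 : (D.coboundary + D.boundary) ⟨X.charFn τ, hdom⟩ ∈
        (D.coboundary + D.boundary).domain := by
      rw [hval]
      exact ⟨trivial, X.F1.add_mem (D.delta_charFn_mem_F1 hsum τ) (D.boundary_charFn_mem_F1 hsum τ)⟩
    refine ⟨⟨hdom, hdom2⟩, fun ρ => ?_⟩
    have h1 : D.formalLaplacian .hodge ⟨X.charFn τ, ⟨hdom, hdom2⟩⟩ =
        D.δ (D.δ (X.charFn τ) + D.boundary ⟨X.charFn τ, charFn_mem_F1 hsum τ⟩) +
        D.boundary (⟨_, D.delta_charFn_mem_F1 hsum τ⟩ + ⟨_, D.boundary_charFn_mem_F1 hsum τ⟩) := rfl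
    rw [h1, map_add, LinearPMap.map_add, D.comp_self, zero_add, Pi.add_apply, Pi.add_apply,
      delta_boundary_charFn D hsum, boundary_delta_charFn D hsum, boundary_boundary_charFn D hsum]
    simp [kernel, LaplacianType.upCoeff, LaplacianType.downCoeff]
    ring

end Coboundary

end WeightedComplex

/-! ### Positive semidefinite kernels and the localized energy estimate -/

/-- Gram kernels with nonnegative coefficients are positive semidefinite. -/
lemma gram_nonneg {ι S : Type*} {c : ι → ℝ} {a : ι → S → ℝ} (hc : ∀ i, 0 ≤ c i)
    (hs : ∀ ρ τ, Summable fun i => c i * (a i ρ * a i τ)) (T : Finset S) (f : S → ℝ) :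
    0 ≤ ∑ τ ∈ T, ∑ ρ ∈ T, (∑' i, c i * (a i ρ * a i τ)) * (f ρ * f τ) := by
  have h : ∑ τ ∈ T, ∑ ρ ∈ T, (∑' i, c i * (a i ρ * a i τ)) * (f ρ * f τ) =
      ∑' i, c i * (∑ ρ ∈ T, f ρ * a i ρ) ^ 2 := by
    simp only [← tsum_mul_right]
    rw [Finset.sum_congr rfl fun τ _ =>
      (Summable.tsum_finsetSum fun ρ _ => (hs ρ τ).mul_right (f ρ * f τ)).symm]
    rw [← Summable.tsum_finsetSum fun τ _ =>
      summable_sum fun ρ _ => (hs ρ τ).mul_right (f ρ * f τ)]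
    refine tsum_congr fun i => ?_
    rw [sq, Finset.sum_mul_sum, Finset.mul_sum, Finset.sum_comm]
    refine Finset.sum_congr rfl fun τ _ => ?_
    rw [Finset.mul_sum]
    refine Finset.sum_congr rfl fun ρ _ => ?_
    ring
  rw [h]
  exact tsum_nonneg fun i => mul_nonneg (hc i) (sq_nonneg _)

/-- The localized energy estimate for a positive semidefinite kernel `K`: the energy of `u` against
`η² u` is bounded from below if `η` is slowly varying with respect to `K`. -/
lemma sum_kernel_cutoff {S : Type*} {K : S → S → ℝ} {m : S → ℝ} {ε : ℝ} {T : Finset S}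
    (hsymm : ∀ ρ τ, K ρ τ = K τ ρ)
    (hpos : ∀ f : S → ℝ, 0 ≤ ∑ τ ∈ T, ∑ ρ ∈ T, K ρ τ * (f ρ * f τ)) {η : S → ℝ}
    (hη : ∀ τ, ∑ ρ ∈ T, |K ρ τ| * (η ρ - η τ) ^ 2 ≤ ε * m τ) (u : S → ℝ) :
    -(ε / 2 * ∑ τ ∈ T, m τ * u τ ^ 2) ≤
      ∑ τ ∈ T, (∑ ρ ∈ T, K ρ τ * u ρ) * (η τ ^ 2 * u τ) := by
  have hswap : ∀ F : S → S → ℝ, ∑ τ ∈ T, ∑ ρ ∈ T, F ρ τ = ∑ τ ∈ T, ∑ ρ ∈ T, F τ ρ := fun F =>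
    Finset.sum_comm
  have h1 : ∑ τ ∈ T, (∑ ρ ∈ T, K ρ τ * u ρ) * (η τ ^ 2 * u τ) =
      ∑ τ ∈ T, ∑ ρ ∈ T, K ρ τ * (u ρ * u τ) * η τ ^ 2 := by
    refine Finset.sum_congr rfl fun τ _ => ?_
    rw [Finset.sum_mul]
    exact Finset.sum_congr rfl fun ρ _ => by ring
  have h2 : ∑ τ ∈ T, ∑ ρ ∈ T, K ρ τ * (u ρ * u τ) * η τ ^ 2 =
      ∑ τ ∈ T, ∑ ρ ∈ T, K ρ τ * (u ρ * u τ) * η ρ ^ 2 := by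
    rw [hswap]
    exact Finset.sum_congr rfl fun τ _ => Finset.sum_congr rfl fun ρ _ => by rw [hsymm τ ρ]; ring
  have h3 : ∑ τ ∈ T, ∑ ρ ∈ T, |K ρ τ| * (η ρ - η τ) ^ 2 * u ρ ^ 2 =
      ∑ τ ∈ T, ∑ ρ ∈ T, |K ρ τ| * (η ρ - η τ) ^ 2 * u τ ^ 2 := by
    rw [hswap]
    exact Finset.sum_congr rfl fun τ _ => Finset.sum_congr rfl fun ρ _ => by rw [hsymm τ ρ]; ring
  have h4 : ∑ τ ∈ T, ∑ ρ ∈ T, |K ρ τ| * (η ρ - η τ) ^ 2 * u τ ^ 2 ≤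
      ε * ∑ τ ∈ T, m τ * u τ ^ 2 := by
    rw [Finset.mul_sum]
    refine Finset.sum_le_sum fun τ _ => ?_
    rw [← Finset.sum_mul, ← mul_assoc]
    exact mul_le_mul_of_nonneg_right (hη τ) (sq_nonneg _)
  have h5 := hpos fun τ => η τ * u τ
  -- Termwise this is `(η_τ² + η_ρ²) / 2 = η_ρ η_τ + (η_ρ - η_τ)² / 2`, with `|u_ρ u_τ| ≤ (u_ρ² +
  -- u_τ²) / 2` in the error term. The main term is the energy of `η u`, which is nonnegative by
  -- `h5`.
  have h6 : ∑ τ ∈ T, ∑ ρ ∈ T, (K ρ τ * (η ρ * u ρ * (η τ * u τ)) -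
        (|K ρ τ| * (η ρ - η τ) ^ 2 * u ρ ^ 2 + |K ρ τ| * (η ρ - η τ) ^ 2 * u τ ^ 2) / 4) ≤
      ∑ τ ∈ T, ∑ ρ ∈ T, (K ρ τ * (u ρ * u τ) * η τ ^ 2 + K ρ τ * (u ρ * u τ) * η ρ ^ 2) / 2 := by
    refine Finset.sum_le_sum fun τ _ => Finset.sum_le_sum fun ρ _ => ?_
    have h7 : |K ρ τ * (u ρ * u τ)| ≤ |K ρ τ| * ((u ρ ^ 2 + u τ ^ 2) / 2) := by
      rw [abs_mul]
      refine mul_le_mul_of_nonneg_left ?_ (abs_nonneg _)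
      rw [abs_le]
      constructor <;> nlinarith [sq_nonneg (u ρ + u τ), sq_nonneg (u ρ - u τ)]
    nlinarith [mul_le_mul_of_nonneg_right (neg_le_of_abs_le h7) (sq_nonneg (η ρ - η τ))]
  simp only [Finset.sum_sub_distrib, ← Finset.sum_div, Finset.sum_add_distrib] at h6
  rw [h1]
  linarith

/-! ### Positivity of the Laplacian kernels and splitting off the empty face -/

namespace WeightedComplex

variable {V : Type*} {X : WeightedComplex V}

/-- A member of `Σ` as an element of the type of simplices. -/
def ofMem {s : Finset V} (h : s ∈ X.simplices) : X.Simplex := ⟨s, h⟩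

@[simp]
lemma ofMem_val {s : Finset V} (h : s ∈ X.simplices) : (ofMem h).1 = s := rfl

namespace Coboundary

variable (D : X.Coboundary) (t : LaplacianType)

lemma summable_upKernel (hsum : X.LocallySummable) (ρ τ : X.Simplex) :
    Summable fun σ => X.wt σ * (D.sgn ρ σ * D.sgn τ σ) := by
  refine Summable.of_norm_bounded (D.summable_wt_sgn hsum τ) fun σ => ?_
  rw [Real.norm_eq_abs, abs_mul, abs_mul, abs_of_pos (wt_pos σ)]
  exact mul_le_mul_of_nonneg_left (mul_le_of_le_one_left (abs_nonneg _) (D.abs_sgn_le ρ σ))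
    (wt_pos σ).le

lemma summable_sgn (c : X.Simplex → ℝ) (ρ τ : X.Simplex) :
    Summable fun κ => c κ * ((X.wt ρ * D.sgn κ ρ) * (X.wt τ * D.sgn κ τ)) := by
  refine summable_of_hasFiniteSupport ((finite_faces τ).subset fun κ hκ => ?_)
  exact isFace_of_sgn_ne_zero
    (right_ne_zero_of_mul (right_ne_zero_of_mul (right_ne_zero_of_mul hκ)))

lemma upKernel_comm (ρ τ : X.Simplex) : D.upKernel ρ τ = D.upKernel τ ρ :=
  tsum_congr fun σ => by ring

lemma downKernel_comm (ρ τ : X.Simplex) : D.downKernel ρ τ = D.downKernel τ ρ :=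
  tsum_congr fun σ => by ring

lemma kernel_comm (ρ τ : X.Simplex) : D.kernel t ρ τ = D.kernel t τ ρ := by
  rw [kernel, kernel, upKernel_comm, downKernel_comm]

lemma _root_.LaplacianType.upCoeff_nonneg (t : LaplacianType) : 0 ≤ t.upCoeff := by
  cases t <;> simp [LaplacianType.upCoeff]

lemma _root_.LaplacianType.downCoeff_nonneg (t : LaplacianType) : 0 ≤ t.downCoeff := by
  cases t <;> simp [LaplacianType.downCoeff]

lemma sum_combination {S : Type*} (a b : ℝ) (K L : S → S → ℝ) (T : Finset S) (f : S → ℝ) :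
    ∑ τ ∈ T, ∑ ρ ∈ T, (a * K ρ τ + b * L ρ τ) * (f ρ * f τ) =
      a * ∑ τ ∈ T, ∑ ρ ∈ T, K ρ τ * (f ρ * f τ) + b * ∑ τ ∈ T, ∑ ρ ∈ T, L ρ τ * (f ρ * f τ) := by
  simp only [Finset.mul_sum, ← Finset.sum_add_distrib]
  exact Finset.sum_congr rfl fun τ _ => Finset.sum_congr rfl fun ρ _ => by ring

lemma upKernel_nonneg (hsum : X.LocallySummable) (T : Finset X.Simplex) (f : X.Simplex → ℝ) :
    0 ≤ ∑ τ ∈ T, ∑ ρ ∈ T, D.upKernel ρ τ * (f ρ * f τ) :=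
  gram_nonneg (a := fun σ τ => D.sgn τ σ) (fun σ => (wt_pos σ).le) (D.summable_upKernel hsum) T f

lemma kernel_nonneg (hsum : X.LocallySummable) (T : Finset X.Simplex) (f : X.Simplex → ℝ) :
    0 ≤ ∑ τ ∈ T, ∑ ρ ∈ T, D.kernel t ρ τ * (f ρ * f τ) := by
  simp only [kernel, sum_combination]
  refine add_nonneg (mul_nonneg t.upCoeff_nonneg (D.upKernel_nonneg hsum T f))
    (mul_nonneg t.downCoeff_nonneg ?_)
  exact gram_nonneg (a := fun κ τ => X.wt τ * D.sgn κ τ) (fun κ => (inv_pos.2 (wt_pos κ)).le)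
    (D.summable_sgn _) T f

open Classical in
/-- The part of the kernel of `δ∂` that comes from the nonempty faces. -/
noncomputable def properDownKernel (ρ τ : X.Simplex) : ℝ :=
  ∑' κ, (if κ.1.Nonempty then (X.wt κ)⁻¹ else 0) * ((X.wt ρ * D.sgn κ ρ) * (X.wt τ * D.sgn κ τ))

open Classical in
/-- The vector whose square is the part of the kernel of `δ∂` that comes from the empty face. -/
noncomputable def emptyVec (τ : X.Simplex) : ℝ :=
  if h : ∅ ∈ X.simplices then (√(X.wt (ofMem h)))⁻¹ * (X.wt τ * D.sgn (ofMem h) τ) else 0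

/-- The kernel is a sum over common faces, and at most one of them is empty. That single summand
factors into a function of `ρ` times the same function of `τ`. -/
lemma downKernel_eq (ρ τ : X.Simplex) :
    D.downKernel ρ τ = D.properDownKernel ρ τ + D.emptyVec ρ * D.emptyVec τ := by
  classical
  have h1 : D.downKernel ρ τ - D.properDownKernel ρ τ = ∑' κ : X.Simplex,
      (if κ.1.Nonempty then 0 else (X.wt κ)⁻¹) * ((X.wt ρ * D.sgn κ ρ) * (X.wt τ * D.sgn κ τ)) := by
    rw [downKernel, properDownKernel, ← (D.summable_sgn _ ρ τ).tsum_sub (D.summable_sgn _ ρ τ)]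
    refine tsum_congr fun κ => ?_
    split_ifs <;> ring
  have h2 : ∑' κ : X.Simplex,
      (if κ.1.Nonempty then 0 else (X.wt κ)⁻¹) * ((X.wt ρ * D.sgn κ ρ) * (X.wt τ * D.sgn κ τ)) =
      D.emptyVec ρ * D.emptyVec τ := by
    by_cases h : ∅ ∈ X.simplices
    · rw [tsum_eq_single (ofMem h)]
      · rw [emptyVec, emptyVec, dif_pos h, dif_pos h, if_neg (by simp)]
        have h3 : (X.wt (ofMem h))⁻¹ = (√(X.wt (ofMem h)))⁻¹ * (√(X.wt (ofMem h)))⁻¹ := by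
          rw [← mul_inv, Real.mul_self_sqrt (wt_pos _).le]
        rw [h3]
        ring
      · intro κ hκ
        rw [if_pos, zero_mul]
        rw [Finset.nonempty_iff_ne_empty]
        exact fun h4 => hκ (Subtype.ext h4)
    · rw [emptyVec, dif_neg h, zero_mul]
      refine (tsum_congr fun κ => ?_).trans tsum_zero
      rw [if_pos, zero_mul]
      rw [Finset.nonempty_iff_ne_empty]
      exact fun h4 => h (h4 ▸ κ.2)
  rw [← h2, ← h1]
  ring

/-- The kernel of the Laplacian without the contribution of the empty face to `δ∂`. -/
noncomputable def properKernel (ρ τ : X.Simplex) : ℝ :=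
  t.upCoeff * D.upKernel ρ τ + t.downCoeff * D.properDownKernel ρ τ

lemma kernel_eq (ρ τ : X.Simplex) : D.kernel t ρ τ =
    D.properKernel t ρ τ + t.downCoeff * (D.emptyVec ρ * D.emptyVec τ) := by
  rw [kernel, properKernel, downKernel_eq]
  ring

lemma properKernel_comm (ρ τ : X.Simplex) : D.properKernel t ρ τ = D.properKernel t τ ρ := by
  have h : D.properDownKernel ρ τ = D.properDownKernel τ ρ := tsum_congr fun σ => by ring
  rw [properKernel, properKernel, upKernel_comm, h]

lemma properKernel_nonneg (hsum : X.LocallySummable) (T : Finset X.Simplex)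
    (f : X.Simplex → ℝ) :
    0 ≤ ∑ τ ∈ T, ∑ ρ ∈ T, D.properKernel t ρ τ * (f ρ * f τ) := by
  classical
  simp only [properKernel, sum_combination]
  refine add_nonneg (mul_nonneg t.upCoeff_nonneg (D.upKernel_nonneg hsum T f))
    (mul_nonneg t.downCoeff_nonneg ?_)
  refine gram_nonneg (a := fun κ τ => X.wt τ * D.sgn κ τ) (fun κ => ?_) (D.summable_sgn _) T f
  split_ifs
  · exact (inv_pos.2 (wt_pos κ)).le
  · exact le_rfl

/-- If the empty simplex is present, the sum is at most the total weight of its cofaces divided by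
its own weight, which is finite by local summability. -/
lemma summable_emptyVec (hsum : X.LocallySummable) :
    Summable fun τ => (X.wt τ)⁻¹ * D.emptyVec τ ^ 2 := by
  by_cases h : ∅ ∈ X.simplices
  · refine Summable.of_nonneg_of_le (fun τ => mul_nonneg (inv_pos.2 (wt_pos τ)).le (sq_nonneg _))
      (fun τ => ?_) ((D.summable_wt_sgn hsum (ofMem h)).mul_left (X.wt (ofMem h))⁻¹)
    rw [emptyVec, dif_pos h, mul_pow, inv_pow, Real.sq_sqrt (wt_pos _).le, mul_left_comm]
    refine mul_le_mul_of_nonneg_left ?_ (inv_pos.2 (wt_pos _)).le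
    have h1 : (X.wt τ)⁻¹ * (X.wt τ * D.sgn (ofMem h) τ) ^ 2 = X.wt τ * |D.sgn (ofMem h) τ| ^ 2 := by
      have := (wt_pos τ).ne'
      rw [sq_abs]
      field_simp
    rw [h1]
    refine mul_le_mul_of_nonneg_left ?_ (wt_pos τ).le
    nlinarith [abs_nonneg (D.sgn (ofMem h) τ), D.abs_sgn_le (ofMem h) τ]
  · simp [emptyVec, h, summable_zero]

/-- The rows of the proper kernel are finite if each vertex is in finitely many simplices. -/
lemma finite_support_properKernel (hfin : ∀ v : V, {σ : X.Simplex | v ∈ σ.1}.Finite)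
    (τ : X.Simplex) : (Function.support fun ρ => D.properKernel t ρ τ).Finite := by
  have hA : (⋃ v ∈ τ.1, ⋃ σ ∈ {σ : X.Simplex | v ∈ σ.1}, {ρ : X.Simplex | ρ.1 ⊆ σ.1}).Finite :=
    τ.1.finite_toSet.biUnion fun v _ => (hfin v).biUnion fun σ _ => finite_subsets σ
  refine (hA.union (Set.finite_singleton τ)).subset fun ρ hρ => ?_
  have h1 : D.upKernel ρ τ ≠ 0 ∨ D.properDownKernel ρ τ ≠ 0 := by
    by_contra! h
    exact hρ (by simp [properKernel, h.1, h.2])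
  rcases h1 with h1 | h1
  · obtain ⟨σ, hσ⟩ : ∃ σ, X.wt σ * (D.sgn ρ σ * D.sgn τ σ) ≠ 0 := by
      by_contra! h
      exact h1 (by simp only [upKernel, h, tsum_zero])
    have hρσ := isFace_of_sgn_ne_zero (left_ne_zero_of_mul (right_ne_zero_of_mul hσ))
    have hτσ := isFace_of_sgn_ne_zero (right_ne_zero_of_mul (right_ne_zero_of_mul hσ))
    -- The empty simplex may have infinitely many cofaces, but a simplex sharing a coface with it
    -- has the same cardinality and is therefore empty too.
    rcases τ.1.eq_empty_or_nonempty with h0 | ⟨v, hv⟩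
    · right
      have h3 : ρ.1.card = τ.1.card := by have := hρσ.2; have := hτσ.2; omega
      rw [h0, Finset.card_empty, Finset.card_eq_zero] at h3
      exact Subtype.ext (h3.trans h0.symm)
    · left
      simp only [Set.mem_iUnion]
      exact ⟨v, hv, σ, hτσ.1 hv, hρσ.1⟩
  · left
    obtain ⟨κ, hκ⟩ : ∃ κ : X.Simplex, ¬ (κ.1.Nonempty → X.wt ρ * D.sgn κ ρ * (X.wt τ * D.sgn κ τ) = 0) := by
      classical
      by_contra! h
      refine h1 ((tsum_congr fun κ => ?_).trans tsum_zero)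
      split_ifs with h2
      · rw [h κ h2, mul_zero]
      · rw [zero_mul]
    push Not at hκ
    obtain ⟨⟨v, hv⟩, hκ⟩ := hκ
    have hκρ := isFace_of_sgn_ne_zero (right_ne_zero_of_mul (left_ne_zero_of_mul hκ))
    have hκτ := isFace_of_sgn_ne_zero (right_ne_zero_of_mul (right_ne_zero_of_mul hκ))
    simp only [Set.mem_iUnion]
    exact ⟨v, hκτ.1 hv, ρ, hκρ.1 hv, Finset.Subset.refl _⟩

/-- A column of the kernel is a finitely supported function plus a multiple of `emptyVec`, and both
are square summable with respect to `1/m`. -/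
lemma summable_kernel_sq (hsum : X.LocallySummable)
    (hfin : ∀ v : V, {σ : X.Simplex | v ∈ σ.1}.Finite) (τ : X.Simplex) :
    Summable fun ρ => X.wt ρ * ((X.wt ρ)⁻¹ * D.kernel t ρ τ) ^ 2 := by
  have h1 : Summable fun ρ => (X.wt ρ)⁻¹ * D.properKernel t ρ τ ^ 2 := by
    refine summable_of_hasFiniteSupport ((D.finite_support_properKernel t hfin τ).subset ?_)
    intro ρ hρ h
    exact hρ (by simp only [show D.properKernel t ρ τ = 0 from h]; simp)
  refine Summable.of_nonneg_of_le (fun ρ => mul_nonneg (wt_pos ρ).le (sq_nonneg _)) (fun ρ => ?_)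
    ((h1.mul_left 2).add ((D.summable_emptyVec hsum).mul_left (2 * (t.downCoeff * D.emptyVec τ) ^ 2)))
  have h2 : X.wt ρ * ((X.wt ρ)⁻¹ * D.kernel t ρ τ) ^ 2 = (X.wt ρ)⁻¹ * D.kernel t ρ τ ^ 2 := by
    have := (wt_pos ρ).ne'
    field_simp
  have h3 : 2 * ((X.wt ρ)⁻¹ * D.properKernel t ρ τ ^ 2) +
      2 * (t.downCoeff * D.emptyVec τ) ^ 2 * ((X.wt ρ)⁻¹ * D.emptyVec ρ ^ 2) =
      (X.wt ρ)⁻¹ * (2 * D.properKernel t ρ τ ^ 2 +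
        2 * (t.downCoeff * (D.emptyVec ρ * D.emptyVec τ)) ^ 2) := by ring
  rw [h2, h3, kernel_eq]
  refine mul_le_mul_of_nonneg_left ?_ (inv_pos.2 (wt_pos ρ)).le
  nlinarith [sq_nonneg (D.properKernel t ρ τ - t.downCoeff * (D.emptyVec ρ * D.emptyVec τ))]

/-- The formal Laplacian on finitely supported functions in terms of its kernel. -/
lemma formalLaplacian_apply (hsum : X.LocallySummable)
    (hfin : ∀ v : V, {σ : X.Simplex | v ∈ σ.1}.Finite) (f : X.Simplex → ℝ) (T : Finset X.Simplex) :
    ∃ hf : ∑ τ ∈ T, f τ • X.charFn τ ∈ (D.formalLaplacian t).domain,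
      (∀ ρ, D.formalLaplacian t ⟨_, hf⟩ ρ = (X.wt ρ)⁻¹ * ∑ τ ∈ T, D.kernel t ρ τ * f τ) ∧
      MemLp (D.formalLaplacian t ⟨_, hf⟩) 2 X.measure := by
  choose hc hv using D.formalLaplacian_charFn t hsum
  have hf : ∑ τ ∈ T, f τ • X.charFn τ ∈ (D.formalLaplacian t).domain :=
    Submodule.sum_mem _ fun τ _ => Submodule.smul_mem _ _ (hc τ)
  have h1 : (⟨_, hf⟩ : (D.formalLaplacian t).domain) = ∑ τ ∈ T, f τ • ⟨X.charFn τ, hc τ⟩ := by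
    apply Subtype.ext
    simp
  have h2 : D.formalLaplacian t ⟨_, hf⟩ =
      ∑ τ ∈ T, f τ • D.formalLaplacian t ⟨X.charFn τ, hc τ⟩ := by
    rw [h1, ← LinearPMap.toFun_eq_coe, map_sum]
    simp only [map_smul]
    rfl
  refine ⟨hf, fun ρ => ?_, ?_⟩
  · rw [h2, Finset.sum_apply, Finset.mul_sum]
    refine Finset.sum_congr rfl fun τ _ => ?_
    rw [Pi.smul_apply, hv, smul_eq_mul]
    ring
  · rw [h2]
    refine memLp_finsetSum' _ fun τ _ => MemLp.const_smul ?_ _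
    refine memLp_two_iff_summable.2 ?_
    simp only [hv]
    exact D.summable_kernel_sq t hsum hfin τ

end Coboundary

end WeightedComplex

/-! ### Vanishing of square summable solutions -/

/-- A square summable solution `u` of `(K + b g gᵀ + m) u = 0` vanishes if `K` is positive
semidefinite and there are cutoff functions that vary slowly with respect to `K`. -/
lemma eq_zero_of_cutoff {S : Type*} {K : S → S → ℝ} {m g u : S → ℝ} {b : ℝ} (hm : ∀ τ, 0 < m τ)
    (hb : 0 ≤ b) (hsymm : ∀ ρ τ, K ρ τ = K τ ρ)
    (hpos : ∀ (T : Finset S) (f : S → ℝ), 0 ≤ ∑ τ ∈ T, ∑ ρ ∈ T, K ρ τ * (f ρ * f τ))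
    (hfin : ∀ τ, (Function.support fun ρ => K ρ τ).Finite)
    (hu : Summable fun τ => m τ * u τ ^ 2) (hug : Summable fun τ => u τ * g τ)
    (heq : ∀ τ, ∑' ρ, K ρ τ * u ρ + b * (∑' ρ, u ρ * g ρ) * g τ + m τ * u τ = 0)
    (hcut : ∀ (F : Finset S) (ε : ℝ), 0 < ε → ∃ η : S → ℝ, (Function.support η).Finite ∧
      (∀ τ ∈ F, η τ = 1) ∧ (∀ τ, 0 ≤ η τ) ∧ (∀ τ, η τ ≤ 1) ∧
      ∀ (T : Finset S) (τ : S), ∑ ρ ∈ T, |K ρ τ| * (η ρ - η τ) ^ 2 ≤ ε * m τ) (τ₀ : S) :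
    u τ₀ = 0 := by
  classical
  set c := ∑' ρ, u ρ * g ρ with hc
  set A := ∑' τ, m τ * u τ ^ 2 with hA
  have hA0 : 0 ≤ A := tsum_nonneg fun τ => mul_nonneg (hm τ).le (sq_nonneg _)
  have main : ∀ ε : ℝ, 0 < ε → m τ₀ * u τ₀ ^ 2 ≤ ε * (A / 2 + b * |c|) := by
    intro ε hε
    have hug' : Summable fun τ => |u τ * g τ| := hug.abs
    obtain ⟨F₀, hF₀⟩ := (eventually_atTop.1
      (hug'.hasSum.eventually (lt_mem_nhds (sub_lt_self _ hε))))
    have hF := hF₀ (insert τ₀ F₀) (Finset.subset_insert _ _)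
    set F := insert τ₀ F₀ with hFdef
    obtain ⟨η, hηfin, hη1, hηnn, hηle, hηK⟩ := hcut F ε hε
    -- `T` contains the support of `η` and all rows of `K` over it, so every sum in the tested
    -- equation is a finite sum over `T`.
    set T : Finset S := F ∪ hηfin.toFinset ∪ hηfin.toFinset.biUnion fun τ => (hfin τ).toFinset
      with hT
    have hηT : ∀ τ ∉ T, η τ = 0 := by
      intro τ hτ
      by_contra h
      exact hτ (by simp [hT, h])
    have hrow : ∀ τ, η τ ≠ 0 → ∑' ρ, K ρ τ * u ρ = ∑ ρ ∈ T, K ρ τ * u ρ := by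
      intro τ hτ
      refine tsum_eq_sum fun ρ hρ => ?_
      by_contra h
      refine hρ ?_
      simp only [hT, Finset.mem_union, Finset.mem_biUnion, Set.Finite.mem_toFinset]
      exact Or.inr ⟨τ, hτ, left_ne_zero_of_mul h⟩
    have h1 : ∑ τ ∈ T, (∑ ρ ∈ T, K ρ τ * u ρ) * (η τ ^ 2 * u τ) +
        b * c * ∑ τ ∈ T, u τ * g τ * η τ ^ 2 + ∑ τ ∈ T, m τ * u τ ^ 2 * η τ ^ 2 = 0 := by
      rw [Finset.mul_sum, ← Finset.sum_add_distrib, ← Finset.sum_add_distrib]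
      refine Finset.sum_eq_zero fun τ _ => ?_
      by_cases hτ : η τ = 0
      · simp [hτ]
      · rw [← hrow τ hτ]
        linear_combination η τ ^ 2 * u τ * heq τ
    have h2 := sum_kernel_cutoff (T := T) hsymm (hpos T) (hηK T) u
    have h3 : ∑ τ ∈ T, m τ * u τ ^ 2 ≤ A :=
      hu.sum_le_tsum T fun τ _ => mul_nonneg (hm τ).le (sq_nonneg _)
    have hsq : ∀ τ, η τ ^ 2 ≤ 1 := fun τ => by nlinarith [hηnn τ, hηle τ]
    have hsum1 : Summable fun τ => u τ * g τ * η τ ^ 2 :=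
      summable_of_ne_finset_zero (s := T) fun τ hτ => by rw [hηT τ hτ]; ring
    have hsum2 : Summable fun τ => |u τ * g τ| * η τ ^ 2 :=
      summable_of_ne_finset_zero (s := T) fun τ hτ => by rw [hηT τ hτ]; ring
    -- As `η = 1` on `F` and `0 ≤ η² ≤ 1`, the error is at most the tail of `∑ |u g|` outside `F`,
    -- which `F` was chosen to make smaller than `ε`.
    have h4 : |c - ∑ τ ∈ T, u τ * g τ * η τ ^ 2| ≤ ε := by
      have h5 : ∑ τ ∈ T, u τ * g τ * η τ ^ 2 = ∑' τ, u τ * g τ * η τ ^ 2 :=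
        (tsum_eq_sum fun τ hτ => by rw [hηT τ hτ]; ring).symm
      rw [h5, hc, ← hug.tsum_sub hsum1]
      have h6 : ∀ τ, ‖u τ * g τ - u τ * g τ * η τ ^ 2‖ =
          |u τ * g τ| - |u τ * g τ| * η τ ^ 2 := by
        intro τ
        rw [← mul_one_sub, norm_mul, Real.norm_eq_abs, Real.norm_eq_abs,
          abs_of_nonneg (sub_nonneg.2 (hsq τ))]
        ring
      have h7 : Summable fun τ => ‖u τ * g τ - u τ * g τ * η τ ^ 2‖ := by
        simp only [h6]
        exact hug'.sub hsum2
      refine (norm_tsum_le_tsum_norm h7).trans ?_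
      simp only [h6]
      rw [hug'.tsum_sub hsum2]
      have h8 : ∑ τ ∈ F, |u τ * g τ| ≤ ∑' τ, |u τ * g τ| * η τ ^ 2 := by
        refine le_trans (le_of_eq (Finset.sum_congr rfl fun τ hτ => ?_))
          (hsum2.sum_le_tsum F fun τ _ => mul_nonneg (abs_nonneg _) (sq_nonneg _))
        rw [hη1 τ hτ]
        ring
      linarith
    have h9 : m τ₀ * u τ₀ ^ 2 ≤ ∑ τ ∈ T, m τ * u τ ^ 2 * η τ ^ 2 := by
      have h10 : τ₀ ∈ T := by simp [hT, hFdef]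
      refine le_trans (le_of_eq ?_) (Finset.single_le_sum (f := fun τ => m τ * u τ ^ 2 * η τ ^ 2)
        (fun τ _ => mul_nonneg (mul_nonneg (hm τ).le (sq_nonneg _)) (sq_nonneg _)) h10)
      rw [hη1 τ₀ (by simp [hFdef])]
      ring
    -- The rank-one term is close to `b c²`, which is nonnegative and can be dropped, leaving only
    -- the error.
    have h11 : -(b * |c| * ε) ≤ b * c * ∑ τ ∈ T, u τ * g τ * η τ ^ 2 := by
      have h12 : c * (c - ∑ τ ∈ T, u τ * g τ * η τ ^ 2) ≤ |c| * ε := by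
        refine (le_abs_self _).trans ?_
        rw [abs_mul]
        exact mul_le_mul_of_nonneg_left h4 (abs_nonneg _)
      nlinarith [mul_le_mul_of_nonneg_left h12 hb, mul_nonneg hb (sq_nonneg c)]
    nlinarith [mul_le_mul_of_nonneg_left h3 hε.le]
  have h0 : m τ₀ * u τ₀ ^ 2 ≤ 0 := by
    refine le_of_forall_pos_le_add fun δ hδ => ?_
    have hB : 0 < A / 2 + b * |c| + 1 := by positivity
    refine (main (δ / (A / 2 + b * |c| + 1)) (by positivity)).trans ?_
    rw [zero_add, div_mul_eq_mul_div, div_le_iff₀ hB]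
    nlinarith
  have h1 : u τ₀ ^ 2 = 0 :=
    le_antisymm (nonpos_of_mul_nonpos_right h0 (hm τ₀)) (sq_nonneg _)
  exact pow_eq_zero_iff two_ne_zero |>.1 h1

/-! ### Essential self-adjointness from slowly varying cutoffs -/

namespace WeightedComplex

variable {V : Type*} {X : WeightedComplex V}

namespace Coboundary

variable (D : X.Coboundary) (t : LaplacianType)

lemma mapsFcToL2 (hsum : X.LocallySummable) (hfin : ∀ v : V, {σ : X.Simplex | v ∈ σ.1}.Finite) :
    D.MapsFcToL2 t := by
  intro f hf
  obtain ⟨h1, -, h3⟩ := D.formalLaplacian_apply t hsum hfin f hf.toFinset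
  have h4 := eq_sum_charFn (f := f) (T := hf.toFinset) (by simp)
  have h5 : (⟨_, h1⟩ : (D.formalLaplacian t).domain) = ⟨f, h4 ▸ h1⟩ := Subtype.ext h4.symm
  exact ⟨h4 ▸ h1, h5 ▸ h3⟩

lemma laplacianC_apply (hsum : X.LocallySummable)
    (hfin : ∀ v : V, {σ : X.Simplex | v ∈ σ.1}.Finite) (h : D.MapsFcToL2 t) (f : X.Fc)
    {T : Finset X.Simplex} (hT : Function.support f.1 ⊆ T) (ρ : X.Simplex) :
    D.laplacianC t h f ρ = (X.wt ρ)⁻¹ * ∑ τ ∈ T, D.kernel t ρ τ * f.1 τ := by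
  obtain ⟨h1, h2, -⟩ := D.formalLaplacian_apply t hsum hfin f.1 T
  rw [← h2]
  have h3 : (⇑(D.laplacianC t h f) : X.Simplex → ℝ) = D.formalLaplacian t ⟨f.1, _⟩ :=
    coe_toLp (h f.1 f.2).2
  have h4 : (⟨f.1, (h f.1 f.2).1⟩ : (D.formalLaplacian t).domain) = ⟨_, h1⟩ :=
    Subtype.ext (eq_sum_charFn hT)
  rw [h3, h4]

lemma inner_laplacianC (hsum : X.LocallySummable)
    (hfin : ∀ v : V, {σ : X.Simplex | v ∈ σ.1}.Finite) (h : D.MapsFcToL2 t) (f g : X.Fc)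
    {T : Finset X.Simplex} (hf : Function.support f.1 ⊆ T) (hg : Function.support g.1 ⊆ T) :
    ⟪D.laplacianC t h f, (g : X.L2)⟫_ℝ =
      ∑ ρ ∈ T, ∑ τ ∈ T, D.kernel t ρ τ * (f.1 τ * g.1 ρ) := by
  rw [L2.inner_eq_tsum, tsum_eq_sum (s := T)]
  · refine Finset.sum_congr rfl fun ρ _ => ?_
    rw [D.laplacianC_apply t hsum hfin h f hf, ← mul_assoc, ← mul_assoc,
      mul_inv_cancel₀ (wt_pos ρ).ne', one_mul, Finset.sum_mul]
    exact Finset.sum_congr rfl fun τ _ => by ring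
  · intro ρ hρ
    have h0 : g.1 ρ = 0 := by
      by_contra h1
      exact hρ (hg h1)
    rw [h0, mul_zero, mul_zero]

/-- The Laplacian on finitely supported functions is essentially self-adjoint as soon as there are
slowly varying cutoff functions. -/
theorem isEssentiallySelfAdjoint_of_cutoff (hsum : X.LocallySummable)
    (hfin : ∀ v : V, {σ : X.Simplex | v ∈ σ.1}.Finite)
    (hcut : ∀ (F : Finset X.Simplex) (ε : ℝ), 0 < ε → ∃ η : X.Simplex → ℝ,
      (Function.support η).Finite ∧ (∀ τ ∈ F, η τ = 1) ∧ (∀ τ, 0 ≤ η τ) ∧ (∀ τ, η τ ≤ 1) ∧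
      ∀ (T : Finset X.Simplex) (τ : X.Simplex),
        ∑ ρ ∈ T, |D.properKernel t ρ τ| * (η ρ - η τ) ^ 2 ≤ ε * X.wt τ) (h : D.MapsFcToL2 t) :
    IsEssentiallySelfAdjoint (D.laplacianC t h) := by
  classical
  refine isEssentiallySelfAdjoint_of_nonneg dense_Fc ?_ ?_ ?_
  · intro (f : X.Fc) (g : X.Fc)
    have hff : (Function.support f.1).Finite := f.2
    have hgf : (Function.support g.1).Finite := g.2
    have hf : Function.support f.1 ⊆ ((hff.toFinset ∪ hgf.toFinset : Finset _) : Set X.Simplex) := by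
      simp
    have hg : Function.support g.1 ⊆ ((hff.toFinset ∪ hgf.toFinset : Finset _) : Set X.Simplex) := by
      simp
    rw [D.inner_laplacianC t hsum hfin h f g hf hg, real_inner_comm,
      D.inner_laplacianC t hsum hfin h g f hg hf, Finset.sum_comm]
    refine Finset.sum_congr rfl fun τ _ => Finset.sum_congr rfl fun ρ _ => ?_
    rw [D.kernel_comm t, mul_comm (f.1 τ)]
  · intro (f : X.Fc)
    have hff : (Function.support f.1).Finite := f.2
    have hf : Function.support f.1 ⊆ (hff.toFinset : Set X.Simplex) := by simp
    rw [D.inner_laplacianC t hsum hfin h f f hf hf]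
    refine (D.kernel_nonneg t hsum hff.toFinset f.1).trans_eq ?_
    refine Finset.sum_congr rfl fun τ _ => Finset.sum_congr rfl fun ρ _ => ?_
    rw [D.kernel_comm t]
  · intro u hu
    have hug : Summable fun τ => u τ * D.emptyVec τ := by
      refine Summable.of_norm_bounded (u.summable_sq.add (D.summable_emptyVec hsum)) fun τ => ?_
      have h1 := wt_pos τ
      have h2 : X.wt τ * u τ ^ 2 + (X.wt τ)⁻¹ * D.emptyVec τ ^ 2 =
          (X.wt τ)⁻¹ * ((X.wt τ * |u τ|) ^ 2 + |D.emptyVec τ| ^ 2) := by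
        rw [mul_pow, sq_abs, sq_abs]
        field_simp
      have h3 : ‖u τ * D.emptyVec τ‖ = (X.wt τ)⁻¹ * ((X.wt τ * |u τ|) * |D.emptyVec τ|) := by
        rw [Real.norm_eq_abs, abs_mul]
        field_simp
      rw [h2, h3]
      refine mul_le_mul_of_nonneg_left ?_ (inv_pos.2 h1).le
      nlinarith [sq_nonneg (X.wt τ * |u τ| - |D.emptyVec τ|), sq_nonneg (X.wt τ * |u τ|),
        sq_nonneg |D.emptyVec τ|]
    -- Orthogonality to `(Δ_c + 1) 1_τ` is the pointwise equation at `τ`. The two parts of the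
    -- kernel can be summed separately because one has a finite row and the other is summable
    -- against `u`.
    have heq : ∀ τ, ∑' ρ, D.properKernel t ρ τ * u ρ +
        t.downCoeff * (∑' ρ, u ρ * D.emptyVec ρ) * D.emptyVec τ + X.wt τ * u τ = 0 := by
      intro τ
      have h1 := hu (toFc (X.charFn τ) (finite_support_charFn τ))
      rw [inner_add_right, inner_toFc_charFn, L2.inner_eq_tsum] at h1
      rw [← h1]
      congr 1
      have hs1 : Summable fun ρ => D.properKernel t ρ τ * u ρ :=
        summable_of_hasFiniteSupport ((D.finite_support_properKernel t hfin τ).subset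
          fun ρ hρ => left_ne_zero_of_mul hρ)
      rw [← tsum_mul_left, ← tsum_mul_right, ← hs1.tsum_add
        ((hug.mul_left t.downCoeff).mul_right (D.emptyVec τ))]
      refine tsum_congr fun ρ => ?_
      have hT : Function.support (toFc (X.charFn τ) (finite_support_charFn τ)).1 ⊆
          (({τ} : Finset X.Simplex) : Set X.Simplex) := by
        intro σ hσ
        rw [coe_toFc] at hσ
        by_contra h2
        exact hσ (charFn_of_ne (by simpa using h2))
      rw [D.laplacianC_apply t hsum hfin h _ hT, Finset.sum_singleton, coe_toFc, charFn_self,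
        kernel_eq]
      have := (wt_pos ρ).ne'
      field_simp
    have h0 : (⇑(0 : X.L2) : X.Simplex → ℝ) = 0 := eq_of_ae_eq (Lp.coeFn_zero _ _ _)
    refine L2.ext_fun fun τ => ?_
    rw [h0]
    exact eq_zero_of_cutoff wt_pos t.downCoeff_nonneg (D.properKernel_comm t)
      (D.properKernel_nonneg t hsum) (D.finite_support_properKernel t hfin) u.summable_sq hug heq
      hcut τ

end Coboundary

/-! ### The path pseudometric: finiteness and vertex cutoffs -/

lemma edgeWeight_le_up {t : LaplacianType} (ht : t.upCoeff ≠ 0) {x y : X.Vertex} {τ : X.Simplex}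
    (h : x.1 ∈ τ.1 ∨ y.1 ∈ τ.1) : X.edgeWeight t x y ≤ X.upSum τ ^ (-(1 / 2) : ℝ) := by
  have h1 : X.upWeight x y ≤ X.upSum τ ^ (-(1 / 2) : ℝ) :=
    iInf_le (fun τ : {τ : X.Simplex // x.1 ∈ τ.1 ∨ y.1 ∈ τ.1} => X.upSum τ.1 ^ (-(1 / 2) : ℝ)) ⟨τ, h⟩
  cases t with
  | up => exact h1
  | down => exact absurd rfl ht
  | hodge =>
    refine (ENNReal.div_le_of_le_mul ?_).trans h1
    refine (min_le_left _ _).trans (le_mul_of_one_le_right' ?_)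
    rw [ENNReal.one_le_ofReal, Real.one_le_sqrt]
    norm_num

lemma edgeWeight_le_down {t : LaplacianType} (ht : t.downCoeff ≠ 0) {x y : X.Vertex}
    {τ : X.Simplex} (h : x.1 ∈ τ.1 ∨ y.1 ∈ τ.1) :
    X.edgeWeight t x y ≤ 2⁻¹ * X.downSum τ ^ (-(1 / 2) : ℝ) := by
  have h1 : X.downWeight x y ≤ 2⁻¹ * X.downSum τ ^ (-(1 / 2) : ℝ) :=
    iInf_le (fun τ : {τ : X.Simplex // x.1 ∈ τ.1 ∨ y.1 ∈ τ.1} =>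
      2⁻¹ * X.downSum τ.1 ^ (-(1 / 2) : ℝ)) ⟨τ, h⟩
  cases t with
  | up => exact absurd rfl ht
  | down => exact h1
  | hodge =>
    refine (ENNReal.div_le_of_le_mul ?_).trans h1
    refine (min_le_right _ _).trans (le_mul_of_one_le_right' ?_)
    rw [ENNReal.one_le_ofReal, Real.one_le_sqrt]
    norm_num

lemma rpow_neg_half_ne_top {a : ℝ≥0∞} (h : a ≠ 0) : a ^ (-(1 / 2) : ℝ) ≠ ∞ := by
  rw [Ne, ENNReal.rpow_eq_top_iff]
  simp [h]

/-- A nonempty face as a simplex of `Σ`. -/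
def ofFace {s : Finset V} (h : s ∈ X.faces) (h0 : s.Nonempty) : X.Simplex :=
  ofMem ⟨h, fun h1 => absurd h1 h0.ne_empty⟩

@[simp]
lemma ofFace_val {s : Finset V} (h : s ∈ X.faces) (h0 : s.Nonempty) : (ofFace h h0).1 = s := rfl

lemma upSum_ne_zero {τ σ : X.Simplex} (hτ : τ.1.Nonempty) (h : IsFace τ σ) : X.upSum τ ≠ 0 := by
  rw [upSum, mul_ne_zero_iff, ENNReal.div_ne_zero]
  refine ⟨⟨by simpa using hτ.ne_empty, ENNReal.ofReal_ne_top⟩, fun h1 => ?_⟩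
  have h2 := ENNReal.tsum_eq_zero.1 h1 ⟨σ, h⟩
  rw [ENNReal.ofReal_eq_zero] at h2
  exact absurd (wt_pos σ) (not_lt.2 h2)

lemma downSum_ne_zero {τ τ' κ : X.Simplex} (h : ∀ v, v ∈ κ.1 ↔ v ∈ τ.1 ∧ v ∈ τ'.1)
    (h1 : IsFace κ τ) (h2 : IsFace κ τ') : X.downSum τ ≠ 0 := by
  intro h0
  have h3 := ENNReal.tsum_eq_zero.1 h0 ⟨(κ, τ'), h, h1, h2⟩
  rw [ENNReal.div_eq_zero_iff, ENNReal.ofReal_eq_zero] at h3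
  exact h3.elim (fun h4 => absurd (wt_pos τ') (not_lt.2 h4)) ENNReal.ofReal_ne_top

lemma adj_iff [DecidableEq V] {x y : X.Vertex} :
    X.skeleton.Adj x y ↔ x ≠ y ∧ ({x.1, y.1} : Finset V) ∈ X.faces := by
  constructor
  · rintro ⟨hne, e, he, h2, hx, hy⟩
    exact ⟨hne, X.down_closed e he _ (by simp [Finset.insert_subset_iff, hx, hy])⟩
  · rintro ⟨hne, h⟩
    have h1 : x.1 ≠ y.1 := fun h => hne (Subtype.ext h)
    exact ⟨hne, _, h, Finset.card_pair h1, by simp, by simp⟩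

/-- Edge weights can be infinite when the sums in their definition vanish. An edge at `x` makes the
up sum of `{x}` nonzero. Two edges `{x, y}`, `{x, z}` meeting in `{x}` make the down sum of `{x, y}`
nonzero. Either bounds all edges at `x` at once. A single neighbor does not suffice in the down
case, but is harmless for finiteness. -/
lemma exists_edgeWeight_le (t : LaplacianType) (x : X.Vertex) :
    {y | X.skeleton.Adj x y}.Subsingleton ∨
      ∃ C : ℝ≥0∞, C ≠ ∞ ∧ ∀ y, X.skeleton.Adj x y → X.edgeWeight t x y ≤ C := by
  classical
  by_cases hsub : {y | X.skeleton.Adj x y}.Subsingleton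
  · exact Or.inl hsub
  right
  rw [Set.not_subsingleton_iff] at hsub
  obtain ⟨y, hy, z, hz, hyz⟩ := hsub
  obtain ⟨hxy, hy⟩ := adj_iff.1 hy
  obtain ⟨hxz, hz⟩ := adj_iff.1 hz
  have hxy' : x.1 ≠ y.1 := fun h => hxy (Subtype.ext h)
  have hxz' : x.1 ≠ z.1 := fun h => hxz (Subtype.ext h)
  have hyz' : y.1 ≠ z.1 := fun h => hyz (Subtype.ext h)
  let x' : X.Simplex := ofFace x.2 (Finset.singleton_nonempty _)
  let y' : X.Simplex := ofFace hy (Finset.insert_nonempty _ _)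
  let z' : X.Simplex := ofFace hz (Finset.insert_nonempty _ _)
  have hx'y' : IsFace x' y' := ⟨by simp [x', y'], by simp [x', y', Finset.card_pair hxy']⟩
  have hx'z' : IsFace x' z' := ⟨by simp [x', z'], by simp [x', z', Finset.card_pair hxz']⟩
  by_cases ht : t.upCoeff = 0
  · have ht' : t.downCoeff ≠ 0 := by
      cases t <;> simp_all [LaplacianType.upCoeff, LaplacianType.downCoeff]
    refine ⟨2⁻¹ * X.downSum y' ^ (-(1 / 2) : ℝ), ENNReal.mul_ne_top (by simp)
      (rpow_neg_half_ne_top (downSum_ne_zero (τ' := z') (fun v => ?_) hx'y' hx'z')),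
      fun y _ => edgeWeight_le_down ht' (Or.inl (by simp [y']))⟩
    simp only [x', y', z', ofFace_val, Finset.mem_singleton, Finset.mem_insert]
    constructor
    · rintro rfl
      simp
    · rintro ⟨h1 | h1, h2 | h2⟩
      · exact h1
      · exact h1
      · exact h2
      · exact absurd (h1.symm.trans h2) hyz'
  · exact ⟨X.upSum x' ^ (-(1 / 2) : ℝ),
      rpow_neg_half_ne_top (upSum_ne_zero (Finset.singleton_nonempty _) hx'y'),
      fun y _ => edgeWeight_le_up ht (Or.inl (by simp [x']))⟩

lemma pathDist_self (t : LaplacianType) (x : X.Vertex) : X.pathDist t x x = 0 :=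
  le_antisymm ((iInf_le _ SimpleGraph.Walk.nil).trans_eq (by simp)) zero_le

lemma pathDist_le_add {t : LaplacianType} {o x y : X.Vertex} (h : X.skeleton.Adj x y) :
    X.pathDist t o y ≤ X.pathDist t o x + X.edgeWeight t x y := by
  rw [pathDist, pathDist, ENNReal.iInf_add]
  refine le_iInf fun p => (iInf_le _ (p.concat h)).trans_eq ?_
  simp [SimpleGraph.Walk.darts_concat]

/-- Unless there is at most one neighbor, a uniform bound on the edge weights at `x` puts all
neighbors in one ball. -/
lemma FiniteBalls.finite_neighbors {t : LaplacianType} (hballs : X.FiniteBalls t) (x : X.Vertex) :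
    {y | X.skeleton.Adj x y}.Finite := by
  rcases exists_edgeWeight_le t x with h | ⟨C, hC, h⟩
  · exact h.finite
  · refine (hballs x C.toReal).subset fun y hy => ?_
    refine (pathDist_le_add (o := x) hy).trans ?_
    rw [pathDist_self, zero_add, ENNReal.ofReal_toReal hC]
    exact h y hy

lemma singleton_mem_faces {σ : X.Simplex} {v : V} (h : v ∈ σ.1) : {v} ∈ X.faces :=
  X.down_closed _ σ.2.1 _ (by simpa using h)

/-- A vertex of a simplex. -/
def vertexOf {σ : X.Simplex} {v : V} (h : v ∈ σ.1) : X.Vertex := ⟨v, singleton_mem_faces h⟩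

@[simp]
lemma vertexOf_val {σ : X.Simplex} {v : V} (h : v ∈ σ.1) : (vertexOf h).1 = v := rfl

lemma adj_vertexOf {σ : X.Simplex} {v w : V} (hv : v ∈ σ.1) (hw : w ∈ σ.1) (hne : v ≠ w) :
    X.skeleton.Adj (vertexOf hv) (vertexOf hw) := by
  classical
  refine adj_iff.2 ⟨fun h => hne (congrArg Subtype.val h), X.down_closed _ σ.2.1 _ ?_⟩
  simp [Finset.insert_subset_iff, hv, hw]

lemma finite_subset_coe {A : Set V} (hA : A.Finite) : {σ : X.Simplex | (σ.1 : Set V) ⊆ A}.Finite := by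
  refine Set.Finite.of_finite_image (f := Subtype.val) ?_ Subtype.val_injective.injOn
  refine (hA.toFinset.powerset.finite_toSet).subset ?_
  rintro _ ⟨τ, hτ, rfl⟩
  refine Finset.mem_coe.2 (Finset.mem_powerset.2 fun v hv => ?_)
  exact hA.mem_toFinset.2 (hτ hv)

/-- The vertices of a simplex are pairwise adjacent, so a simplex containing `v` is a subset of `v`
together with its finitely many neighbors. -/
lemma FiniteBalls.finite_cofaces {t : LaplacianType} (hballs : X.FiniteBalls t) (v : V) :
    {σ : X.Simplex | v ∈ σ.1}.Finite := by
  by_cases hv : {v} ∈ X.faces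
  · refine (finite_subset_coe (((hballs.finite_neighbors ⟨v, hv⟩).image Subtype.val).insert v)).subset
      fun σ hσ w hw => ?_
    by_cases h : v = w
    · exact Or.inl h.symm
    · exact Or.inr ⟨vertexOf hw, adj_vertexOf hσ hw h, rfl⟩
  · refine Set.finite_empty.subset fun σ hσ => ?_
    exact hv (singleton_mem_faces hσ)

/-- Lipschitz cutoff functions on the vertices. -/
lemma FiniteBalls.exists_vertex_cutoff {t : LaplacianType} (hballs : X.FiniteBalls t)
    (S : Finset V) {R : ℝ} (hR : 0 < R) : ∃ φ : V → ℝ, (Function.support φ).Finite ∧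
      (∀ x : X.Vertex, x.1 ∈ S → φ x.1 = 1) ∧ (∀ v, 0 ≤ φ v) ∧ (∀ v, φ v ≤ 1) ∧
      ∀ (x y : X.Vertex) (W : ℝ≥0∞), X.skeleton.Adj x y → X.edgeWeight t x y ≤ W →
        X.edgeWeight t y x ≤ W → ENNReal.ofReal |φ x.1 - φ y.1| ≤ W / ENNReal.ofReal R := by
  classical
  set R' := ENNReal.ofReal R with hR'
  have hR0 : R' ≠ 0 := by simpa [hR'] using hR
  have hRt : R' ≠ ∞ := ENNReal.ofReal_ne_top
  -- Distance to `S`, with value `∞` off its connected components. Truncated subtraction in `ψ` then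
  -- gives 0 wherever `d ≥ R`.
  let d : X.Vertex → ℝ≥0∞ := fun x => ⨅ o : {o : X.Vertex // o.1 ∈ S}, X.pathDist t o.1 x
  let ψ : X.Vertex → ℝ≥0∞ := fun x => 1 - d x / R'
  have hψ1 : ∀ x, ψ x ≤ 1 := fun x => tsub_le_self
  have hψt : ∀ x, ψ x ≠ ∞ := fun x => ne_top_of_le_ne_top ENNReal.one_ne_top (hψ1 x)
  have hd : ∀ x y, X.skeleton.Adj x y → d y ≤ d x + X.edgeWeight t x y := by
    intro x y hxy
    simp only [d]
    rw [ENNReal.iInf_add]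
    exact le_iInf fun o => (iInf_le _ o).trans (pathDist_le_add hxy)
  have hψ : ∀ x y W, X.skeleton.Adj x y → X.edgeWeight t x y ≤ W → ψ x ≤ ψ y + W / R' := by
    intro x y W hxy hW
    simp only [ψ]
    rw [tsub_le_iff_left]
    calc (1 : ℝ≥0∞) ≤ d y / R' + (1 - d y / R') := le_add_tsub
      _ ≤ (d x + W) / R' + (1 - d y / R') := by
        gcongr
        exact (hd x y hxy).trans (by gcongr)
      _ = d x / R' + (1 - d y / R' + W / R') := by
        rw [ENNReal.add_div]
        ring
  let φ : V → ℝ := fun v => if h : {v} ∈ X.faces then (ψ ⟨v, h⟩).toReal else 0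
  have hφ : ∀ x : X.Vertex, φ x.1 = (ψ x).toReal := fun x => dif_pos x.2
  have hsub : ∀ x y W, X.skeleton.Adj x y → X.edgeWeight t x y ≤ W →
      ENNReal.ofReal ((ψ x).toReal - (ψ y).toReal) ≤ W / R' := by
    intro x y W hxy hW
    rw [ENNReal.ofReal_sub _ ENNReal.toReal_nonneg, ENNReal.ofReal_toReal (hψt x),
      ENNReal.ofReal_toReal (hψt y), tsub_le_iff_left]
    exact hψ x y W hxy hW
  refine ⟨φ, ?_, fun x hx => ?_, fun v => ?_, fun v => ?_, fun x y W hxy h1 h2 => ?_⟩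
  · have hfin : (⋃ o : {o : X.Vertex // o.1 ∈ S}, {x | X.pathDist t o.1 x ≤ ENNReal.ofReal R}).Finite := by
      have : Finite {o : X.Vertex // o.1 ∈ S} :=
        Finite.of_injective (fun o => (⟨o.1.1, o.2⟩ : {v // v ∈ S})) fun a b h =>
          Subtype.ext (Subtype.ext (by simpa using h))
      exact Set.finite_iUnion fun o => hballs o.1 R
    refine (hfin.image Subtype.val).subset fun v hv => ?_
    by_cases h : {v} ∈ X.faces
    · refine ⟨⟨v, h⟩, ?_, rfl⟩
      have h3 : ψ ⟨v, h⟩ ≠ 0 := by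
        intro h4
        exact hv ((hφ ⟨v, h⟩).trans (by rw [h4, ENNReal.toReal_zero]))
      have h5 : d ⟨v, h⟩ < R' := by
        by_contra! h6
        refine h3 (tsub_eq_zero_of_le ?_)
        rwa [ENNReal.le_div_iff_mul_le (Or.inl hR0) (Or.inl hRt), one_mul]
      obtain ⟨o, ho⟩ := iInf_lt_iff.1 h5
      exact Set.mem_iUnion.2 ⟨o, ho.le⟩
    · exact absurd (dif_neg h) hv
  · have h0 : d x = 0 :=
      le_antisymm ((iInf_le _ (⟨x, hx⟩ : {o : X.Vertex // o.1 ∈ S})).trans_eq (pathDist_self t x))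
        zero_le
    rw [hφ]
    simp [ψ, h0]
  · simp only [φ]
    split_ifs
    · exact ENNReal.toReal_nonneg
    · exact le_rfl
  · simp only [φ]
    split_ifs with h
    · exact ENNReal.toReal_le_of_le_ofReal zero_le_one (by simpa using hψ1 ⟨v, h⟩)
    · exact zero_le_one
  -- The two signs of the difference use the two orientations of the edge, so both are bounded by
  -- the same `W`.
  · rw [hφ, hφ]
    rcases abs_cases ((ψ x).toReal - (ψ y).toReal) with h | h
    · rw [h.1]
      exact hsub x y W hxy h1
    · rw [h.1, neg_sub]
      exact hsub y x W hxy.symm h2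

end WeightedComplex

/-! ### Product cutoffs on simplices -/

lemma ENNReal.rpow_neg_half_div_sq_mul_le (a r : ℝ≥0∞) :
    (a ^ (-(1 / 2) : ℝ) / r) ^ 2 * a ≤ (r ^ 2)⁻¹ := by
  have h1 : (a ^ (-(1 / 2) : ℝ)) ^ 2 = a⁻¹ := by
    rw [← ENNReal.rpow_natCast, ← ENNReal.rpow_mul, ← ENNReal.rpow_neg_one]
    norm_num
  rw [div_eq_mul_inv, mul_pow, h1, ENNReal.inv_pow, mul_right_comm]
  -- For `a = 0` and `a = ∞` the product of `a` and its inverse is 0, hence only an inequality.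
  exact mul_le_of_le_one_left' (ENNReal.inv_mul_le_one a)

lemma abs_prod_insert_sub_prod_insert_le {V : Type*} [DecidableEq V] {φ : V → ℝ}
    (h0 : ∀ v, 0 ≤ φ v) (h1 : ∀ v, φ v ≤ 1) {κ : Finset V} {a b : V} (ha : a ∉ κ) (hb : b ∉ κ) :
    |∏ v ∈ insert b κ, φ v - ∏ v ∈ insert a κ, φ v| ≤ |φ b - φ a| := by
  rw [Finset.prod_insert ha, Finset.prod_insert hb, ← sub_mul, abs_mul,
    abs_of_nonneg (Finset.prod_nonneg fun v _ => h0 v)]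
  exact mul_le_of_le_one_right (abs_nonneg _) (Finset.prod_le_one (fun v _ => h0 v) fun v _ => h1 v)

namespace WeightedComplex

variable {V : Type*} {X : WeightedComplex V}

lemma IsFace.exists_eq_insert [DecidableEq V] {κ τ : X.Simplex} (h : IsFace κ τ) :
    ∃ a ∉ κ.1, τ.1 = insert a κ.1 := by
  have h1 : (τ.1 \ κ.1).card = 1 := by
    rw [Finset.card_sdiff_of_subset h.1, h.2]
    omega
  obtain ⟨a, ha⟩ := Finset.card_eq_one.1 h1
  have h2 : a ∈ τ.1 \ κ.1 := by simp [ha]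
  refine ⟨a, (Finset.mem_sdiff.1 h2).2, ?_⟩
  rw [← Finset.sdiff_union_of_subset h.1, ha, Finset.insert_eq]

lemma IsFace.inter_iff {κ ρ τ : X.Simplex} (h1 : IsFace κ τ) (h2 : IsFace κ ρ) (hne : ρ ≠ τ)
    (v : V) : v ∈ κ.1 ↔ v ∈ τ.1 ∧ v ∈ ρ.1 := by
  classical
  refine ⟨fun h => ⟨h1.1 h, h2.1 h⟩, fun ⟨h3, h4⟩ => ?_⟩
  obtain ⟨a, -, ha⟩ := h1.exists_eq_insert
  obtain ⟨b, -, hb⟩ := h2.exists_eq_insert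
  rw [ha, Finset.mem_insert] at h3
  rw [hb, Finset.mem_insert] at h4
  by_contra h
  have h5 : a = b := (h3.resolve_right h).symm.trans (h4.resolve_right h)
  exact hne (Subtype.ext (by rw [ha, hb, h5]))

/-- A face of `σ` other than `τ` arises by deleting a vertex that belongs to `τ`. This count is the
source of the factor `dim τ + 1` in `upSum`. -/
lemma card_other_faces_le {τ σ : X.Simplex} (h : IsFace τ σ) {T : Finset X.Simplex}
    (hT : ∀ ρ ∈ T, ρ ≠ τ ∧ IsFace ρ σ) : T.card ≤ τ.1.card := by
  classical
  have h1 : T.map ⟨Subtype.val, Subtype.val_injective⟩ ⊆ τ.1.image fun v => σ.1.erase v := by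
    intro s hs
    obtain ⟨ρ, hρ, rfl⟩ := Finset.mem_map.1 hs
    obtain ⟨hne, hρσ⟩ := hT ρ hρ
    obtain ⟨a, ha, haσ⟩ := hρσ.exists_eq_insert
    obtain ⟨b, hb, hbσ⟩ := h.exists_eq_insert
    refine Finset.mem_image.2 ⟨a, ?_, ?_⟩
    · have h2 : a ∈ insert b τ.1 := by rw [← hbσ, haσ]; simp
      rcases Finset.mem_insert.1 h2 with rfl | h2
      · refine absurd (Subtype.ext ?_) hne
        rw [← Finset.erase_insert ha, ← haσ, hbσ, Finset.erase_insert hb]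
      · exact h2
    · rw [haσ, Finset.erase_insert ha]
      rfl
  calc T.card = (T.map ⟨Subtype.val, Subtype.val_injective⟩).card := (Finset.card_map _).symm
    _ ≤ _ := Finset.card_le_card h1
    _ ≤ τ.1.card := Finset.card_image_le

namespace Coboundary

variable (D : X.Coboundary)

open Classical in
lemma abs_upKernel_le (hsum : X.LocallySummable) (ρ τ : X.Simplex) :
    ENNReal.ofReal |D.upKernel ρ τ| ≤
      ∑' σ, if IsFace ρ σ ∧ IsFace τ σ then ENNReal.ofReal (X.wt σ) else 0 := by
  have h1 := (D.summable_upKernel hsum ρ τ).norm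
  refine (ENNReal.ofReal_le_ofReal (norm_tsum_le_tsum_norm h1)).trans ?_
  rw [ENNReal.ofReal_tsum_of_nonneg (fun _ => norm_nonneg _) h1]
  refine ENNReal.tsum_le_tsum fun σ => ?_
  split_ifs with h
  · refine ENNReal.ofReal_le_ofReal ?_
    rw [norm_mul, norm_mul, Real.norm_of_nonneg (wt_pos σ).le]
    exact mul_le_of_le_one_right (wt_pos σ).le
      (mul_le_one₀ (D.abs_sgn_le ρ σ) (norm_nonneg _) (D.abs_sgn_le τ σ))
  · rw [not_and_or] at h
    rcases h with h | h <;> simp [D.sgn_eq_zero h]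

open Classical in
lemma abs_properDownKernel_le (ρ τ : X.Simplex) :
    ENNReal.ofReal |D.properDownKernel ρ τ| ≤
      ∑' κ, if κ.1.Nonempty ∧ IsFace κ τ ∧ IsFace κ ρ then
        ENNReal.ofReal (X.wt τ) * (ENNReal.ofReal (X.wt ρ) / ENNReal.ofReal (X.wt κ)) else 0 := by
  have h1 := (D.summable_sgn (fun κ => if κ.1.Nonempty then (X.wt κ)⁻¹ else 0) ρ τ).norm
  refine (ENNReal.ofReal_le_ofReal (norm_tsum_le_tsum_norm h1)).trans ?_
  rw [ENNReal.ofReal_tsum_of_nonneg (fun _ => norm_nonneg _) h1]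
  refine ENNReal.tsum_le_tsum fun κ => ?_
  split_ifs with h2 h3 h3
  · rw [← ENNReal.ofReal_div_of_pos (wt_pos κ), ← ENNReal.ofReal_mul (wt_pos τ).le]
    refine ENNReal.ofReal_le_ofReal ?_
    have h4 : ‖(X.wt κ)⁻¹ * (X.wt ρ * D.sgn κ ρ * (X.wt τ * D.sgn κ τ))‖ =
        X.wt τ * (X.wt ρ / X.wt κ) * (|D.sgn κ ρ| * |D.sgn κ τ|) := by
      simp only [norm_mul, Real.norm_eq_abs, abs_inv, abs_of_pos (wt_pos _)]
      ring
    rw [h4]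
    exact mul_le_of_le_one_right
      (mul_nonneg (wt_pos τ).le (div_nonneg (wt_pos ρ).le (wt_pos κ).le))
      (mul_le_one₀ (D.abs_sgn_le κ ρ) (abs_nonneg _) (D.abs_sgn_le κ τ))
  · rw [and_iff_right h2, not_and_or] at h3
    rcases h3 with h | h <;> simp [D.sgn_eq_zero h]
  · exact absurd h3.1 h2
  · simp

/-- The diagonal term vanishes. Interchange the sums over `ρ` and `σ`: each coface `σ` of `τ` occurs
for at most `dim τ + 1` other faces `ρ`, which reproduces `upSum`. -/
lemma sum_upKernel_le (hsum : X.LocallySummable) {η : X.Simplex → ℝ} {q : ℝ≥0∞} {τ : X.Simplex}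
    (hq : ∀ ρ σ, ρ ≠ τ → IsFace ρ σ → IsFace τ σ → ENNReal.ofReal ((η ρ - η τ) ^ 2) ≤ q)
    (T : Finset X.Simplex) :
    ∑ ρ ∈ T, ENNReal.ofReal (|D.upKernel ρ τ| * (η ρ - η τ) ^ 2) ≤
      q * X.upSum τ * ENNReal.ofReal (X.wt τ) := by
  classical
  have hw0 : ENNReal.ofReal (X.wt τ) ≠ 0 := by simpa using wt_pos τ
  calc ∑ ρ ∈ T, ENNReal.ofReal (|D.upKernel ρ τ| * (η ρ - η τ) ^ 2)
      ≤ ∑ ρ ∈ T, ∑' σ, if ρ ≠ τ ∧ IsFace ρ σ ∧ IsFace τ σ then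
          ENNReal.ofReal (X.wt σ) * q else 0 := by
        refine Finset.sum_le_sum fun ρ _ => ?_
        by_cases hρ : ρ = τ
        · simp [hρ]
        rw [ENNReal.ofReal_mul (abs_nonneg _)]
        refine (mul_le_mul_left (D.abs_upKernel_le hsum ρ τ) _).trans ?_
        rw [← ENNReal.tsum_mul_right]
        refine ENNReal.tsum_le_tsum fun σ => ?_
        by_cases h : IsFace ρ σ ∧ IsFace τ σ
        · rw [if_pos h, if_pos ⟨hρ, h⟩]
          gcongr
          exact hq ρ σ hρ h.1 h.2
        · rw [if_neg h, zero_mul]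
          exact zero_le
    _ = ∑' σ, ∑ ρ ∈ T, if ρ ≠ τ ∧ IsFace ρ σ ∧ IsFace τ σ then
          ENNReal.ofReal (X.wt σ) * q else 0 :=
        (Summable.tsum_finsetSum fun _ _ => ENNReal.summable).symm
    _ ≤ ∑' σ, Set.indicator {σ : X.Simplex | IsFace τ σ}
          (fun σ => q * τ.1.card * ENNReal.ofReal (X.wt σ)) σ := by
        refine ENNReal.tsum_le_tsum fun σ => ?_
        rw [← Finset.sum_filter, Finset.sum_const, nsmul_eq_mul]
        by_cases h : IsFace τ σ
        · rw [Set.indicator_of_mem (Set.mem_ofPred.2 h)]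
          have h1 : (T.filter fun ρ => ρ ≠ τ ∧ IsFace ρ σ ∧ IsFace τ σ).card ≤ τ.1.card :=
            card_other_faces_le h fun ρ hρ =>
              ⟨(Finset.mem_filter.1 hρ).2.1, (Finset.mem_filter.1 hρ).2.2.1⟩
          calc _ ≤ (τ.1.card : ℝ≥0∞) * (ENNReal.ofReal (X.wt σ) * q) := by gcongr
            _ = _ := by ring
        · simp [h]
    _ = q * τ.1.card * ∑' σ : {σ : X.Simplex // IsFace τ σ}, ENNReal.ofReal (X.wt σ.1) := by
        rw [← ENNReal.tsum_mul_left]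
        exact (tsum_subtype {σ : X.Simplex | IsFace τ σ}
          fun σ => q * τ.1.card * ENNReal.ofReal (X.wt σ)).symm
    _ = q * X.upSum τ * ENNReal.ofReal (X.wt τ) := by
        have h1 : (τ.1.card : ℝ≥0∞) =
            τ.1.card / ENNReal.ofReal (X.wt τ) * ENNReal.ofReal (X.wt τ) :=
          (ENNReal.div_mul_cancel hw0 ENNReal.ofReal_ne_top).symm
        rw [upSum]
        conv_lhs => rw [h1]
        ring

/-- For `ρ ≠ τ` a common face `κ` must be `τ ∩ ρ`, so the pairs `(κ, ρ)` that contribute are among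
those indexing `downSum`. -/
lemma sum_properDownKernel_le {η : X.Simplex → ℝ} {q : ℝ≥0∞} {τ : X.Simplex}
    (hq : ∀ ρ κ, ρ ≠ τ → κ.1.Nonempty → IsFace κ τ → IsFace κ ρ →
      ENNReal.ofReal ((η ρ - η τ) ^ 2) ≤ q) (T : Finset X.Simplex) :
    ∑ ρ ∈ T, ENNReal.ofReal (|D.properDownKernel ρ τ| * (η ρ - η τ) ^ 2) ≤
      q * X.downSum τ * ENNReal.ofReal (X.wt τ) := by
  classical
  let s : Set (X.Simplex × X.Simplex) :=
    {p | (∀ v, v ∈ p.1.1 ↔ v ∈ τ.1 ∧ v ∈ p.2.1) ∧ IsFace p.1 τ ∧ IsFace p.1 p.2}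
  let F : X.Simplex × X.Simplex → ℝ≥0∞ := fun p =>
    q * ENNReal.ofReal (X.wt τ) * (ENNReal.ofReal (X.wt p.2) / ENNReal.ofReal (X.wt p.1))
  calc ∑ ρ ∈ T, ENNReal.ofReal (|D.properDownKernel ρ τ| * (η ρ - η τ) ^ 2)
      ≤ ∑ ρ ∈ T, ∑' κ, s.indicator F (κ, ρ) := by
        refine Finset.sum_le_sum fun ρ _ => ?_
        by_cases hρ : ρ = τ
        · simp [hρ]
        rw [ENNReal.ofReal_mul (abs_nonneg _)]
        refine (mul_le_mul_left (D.abs_properDownKernel_le ρ τ) _).trans ?_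
        rw [← ENNReal.tsum_mul_right]
        refine ENNReal.tsum_le_tsum fun κ => ?_
        by_cases h : κ.1.Nonempty ∧ IsFace κ τ ∧ IsFace κ ρ
        · have h1 : (κ, ρ) ∈ s := ⟨h.2.1.inter_iff h.2.2 hρ, h.2⟩
          rw [if_pos h, Set.indicator_of_mem h1]
          calc _ ≤ ENNReal.ofReal (X.wt τ) *
                (ENNReal.ofReal (X.wt ρ) / ENNReal.ofReal (X.wt κ)) * q := by
                gcongr
                exact hq ρ κ hρ h.1 h.2.1 h.2.2
            _ = F (κ, ρ) := by simp only [F]; ring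
        · rw [if_neg h, zero_mul]
          exact zero_le
    _ ≤ ∑' ρ, ∑' κ, s.indicator F (κ, ρ) := ENNReal.sum_le_tsum T
    _ = ∑' κ, ∑' ρ, s.indicator F (κ, ρ) := ENNReal.tsum_comm
    _ = ∑' p, s.indicator F p := ENNReal.tsum_prod.symm
    _ = ∑' p : s, F p := (tsum_subtype s F).symm
    _ = q * X.downSum τ * ENNReal.ofReal (X.wt τ) := by
        simp only [F]
        rw [ENNReal.tsum_mul_left, mul_right_comm]
        rfl

end Coboundary

open Classical in
/-- Products of vertex cutoffs are cutoffs on simplices: common cofaces. -/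
lemma sq_prod_sub_prod_le_of_coface {t : LaplacianType} (ht : t.upCoeff ≠ 0) {φ : V → ℝ}
    {r : ℝ≥0∞} (h0 : ∀ v, 0 ≤ φ v) (h1 : ∀ v, φ v ≤ 1)
    (hφ : ∀ (x y : X.Vertex) (W : ℝ≥0∞), X.skeleton.Adj x y → X.edgeWeight t x y ≤ W →
        X.edgeWeight t y x ≤ W → ENNReal.ofReal |φ x.1 - φ y.1| ≤ W / r)
    {ρ τ σ : X.Simplex} (hne : ρ ≠ τ) (hρ : IsFace ρ σ) (hτ : IsFace τ σ) :
    ENNReal.ofReal ((∏ v ∈ ρ.1, φ v - ∏ v ∈ τ.1, φ v) ^ 2) ≤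
      (X.upSum τ ^ (-(1 / 2) : ℝ) / r) ^ 2 := by
  rw [← sq_abs, ENNReal.ofReal_pow (abs_nonneg _)]
  gcongr
  obtain ⟨a, ha, haσ⟩ := hρ.exists_eq_insert
  obtain ⟨b, hb, hbσ⟩ := hτ.exists_eq_insert
  have haσ' : a ∈ σ.1 := by rw [haσ]; simp
  have hbσ' : b ∈ σ.1 := by rw [hbσ]; simp
  -- `ρ` arises from `τ` by exchanging `a` for `b`. Both lie in `σ`, so they are adjacent, and this
  -- edge touches `τ` at `a`.
  have hab : a ≠ b := by
    rintro rfl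
    refine hne (Subtype.ext ?_)
    rw [← Finset.erase_insert ha, ← haσ, hbσ, Finset.erase_insert hb]
  have haτ : a ∈ τ.1 := (Finset.mem_insert.1 (hbσ ▸ haσ')).resolve_left hab
  have h3 : τ.1 = insert a (τ.1.erase a) := (Finset.insert_erase haτ).symm
  have h4 : ρ.1 = insert b (τ.1.erase a) := by
    rw [← Finset.erase_insert ha, ← haσ, hbσ, Finset.erase_insert_of_ne hab.symm]
  rw [h3, h4]
  refine (ENNReal.ofReal_le_ofReal (abs_prod_insert_sub_prod_insert_le h0 h1
    (Finset.notMem_erase a _) fun h => hb (Finset.mem_of_mem_erase h))).trans ?_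
  exact hφ (vertexOf hbσ') (vertexOf haσ') _ (adj_vertexOf _ _ hab.symm)
    (edgeWeight_le_up ht (Or.inr haτ)) (edgeWeight_le_up ht (Or.inl haτ))

open Classical in
/-- Products of vertex cutoffs are cutoffs on simplices: common nonempty faces. -/
lemma sq_prod_sub_prod_le_of_face {t : LaplacianType} (ht : t.downCoeff ≠ 0) {φ : V → ℝ}
    {r : ℝ≥0∞} (h0 : ∀ v, 0 ≤ φ v) (h1 : ∀ v, φ v ≤ 1)
    (hφ : ∀ (x y : X.Vertex) (W : ℝ≥0∞), X.skeleton.Adj x y → X.edgeWeight t x y ≤ W →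
        X.edgeWeight t y x ≤ W → ENNReal.ofReal |φ x.1 - φ y.1| ≤ W / r)
    {ρ τ κ : X.Simplex} (hκ : κ.1.Nonempty) (hτ : IsFace κ τ) (hρ : IsFace κ ρ) :
    ENNReal.ofReal ((∏ v ∈ ρ.1, φ v - ∏ v ∈ τ.1, φ v) ^ 2) ≤
      (X.downSum τ ^ (-(1 / 2) : ℝ) / r) ^ 2 := by
  rw [← sq_abs, ENNReal.ofReal_pow (abs_nonneg _)]
  gcongr
  obtain ⟨a, ha, haτ⟩ := hτ.exists_eq_insert
  obtain ⟨b, hb, hbρ⟩ := hρ.exists_eq_insert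
  obtain ⟨c, hc⟩ := hκ
  have haτ' : a ∈ τ.1 := by rw [haτ]; simp
  have hbρ' : b ∈ ρ.1 := by rw [hbρ]; simp
  have hcτ : c ∈ τ.1 := hτ.1 hc
  have hcρ : c ∈ ρ.1 := hρ.1 hc
  have hac : a ≠ c := fun h => ha (h ▸ hc)
  have hbc : b ≠ c := fun h => hb (h ▸ hc)
  set W := X.downSum τ ^ (-(1 / 2) : ℝ) with hW
  -- The exchanged vertices `a` and `b` need not be adjacent, but both are adjacent to a vertex `c`
  -- of `κ`. The two edges of this detour both touch `τ`, and the factor `1/2` in `w⁻` pays for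
  -- there being two. Without a vertex in `κ` there is no such detour.
  have h3 : ENNReal.ofReal |φ b - φ c| ≤ 2⁻¹ * W / r :=
    hφ (vertexOf hbρ') (vertexOf hcρ) _ (adj_vertexOf _ _ hbc)
      (edgeWeight_le_down ht (Or.inr hcτ)) (edgeWeight_le_down ht (Or.inl hcτ))
  have h4 : ENNReal.ofReal |φ c - φ a| ≤ 2⁻¹ * W / r :=
    hφ (vertexOf hcτ) (vertexOf haτ') _ (adj_vertexOf _ _ hac.symm)
      (edgeWeight_le_down ht (Or.inl hcτ)) (edgeWeight_le_down ht (Or.inl haτ'))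
  have h5 : |∏ v ∈ ρ.1, φ v - ∏ v ∈ τ.1, φ v| ≤ |φ b - φ c| + |φ c - φ a| := by
    rw [haτ, hbρ]
    exact (abs_prod_insert_sub_prod_insert_le h0 h1 ha hb).trans (abs_sub_le _ _ _)
  refine (ENNReal.ofReal_le_ofReal h5).trans ?_
  rw [ENNReal.ofReal_add (abs_nonneg _) (abs_nonneg _)]
  refine (add_le_add h3 h4).trans_eq ?_
  rw [← ENNReal.add_div, ← add_mul, ENNReal.inv_two_add_inv_two, one_mul]

/-- If the balls of the path pseudometric are finite, there are slowly varying cutoff functions. -/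
theorem FiniteBalls.exists_cutoff {t : LaplacianType} (hballs : X.FiniteBalls t)
    (hsum : X.LocallySummable) (D : X.Coboundary) (F : Finset X.Simplex) {ε : ℝ} (hε : 0 < ε) :
    ∃ η : X.Simplex → ℝ, (Function.support η).Finite ∧ (∀ τ ∈ F, η τ = 1) ∧ (∀ τ, 0 ≤ η τ) ∧
      (∀ τ, η τ ≤ 1) ∧ ∀ (T : Finset X.Simplex) (τ : X.Simplex),
        ∑ ρ ∈ T, |D.properKernel t ρ τ| * (η ρ - η τ) ^ 2 ≤ ε * X.wt τ := by
  classical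
  -- With this radius `R⁻² = ε / 2`, so the up and down parts use half of `ε` each.
  have hR : 0 < √(2 / ε) := Real.sqrt_pos.2 (by positivity)
  obtain ⟨φ, hfin, hone, h0, h1, hφ⟩ :=
    hballs.exists_vertex_cutoff (F.biUnion fun τ => τ.1) hR
  have hr : (ENNReal.ofReal √(2 / ε) ^ 2)⁻¹ = ENNReal.ofReal (ε / 2) := by
    rw [← ENNReal.ofReal_pow hR.le, Real.sq_sqrt (by positivity),
      ← ENNReal.ofReal_inv_of_pos (by positivity), inv_div]
  -- A nonzero product has all its vertices in the support of `φ`, which leaves finitely many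
  -- simplices. The empty simplex gets the value 1.
  refine ⟨fun τ => ∏ v ∈ τ.1, φ v, (finite_subset_coe hfin).subset fun τ hτ v hv => ?_,
    fun τ hτ => Finset.prod_eq_one fun v hv => ?_, fun τ => Finset.prod_nonneg fun v _ => h0 v,
    fun τ => Finset.prod_le_one (fun v _ => h0 v) fun v _ => h1 v, fun T τ => ?_⟩
  · exact Finset.prod_ne_zero_iff.1 hτ v hv
  · exact hone (vertexOf hv) (Finset.mem_biUnion.2 ⟨τ, hτ, hv⟩)
  · set η : X.Simplex → ℝ := fun τ => ∏ v ∈ τ.1, φ v with hη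
    have hwt := wt_pos τ
    have hup : t.upCoeff * ∑ ρ ∈ T, |D.upKernel ρ τ| * (η ρ - η τ) ^ 2 ≤ ε / 2 * X.wt τ := by
      by_cases ht : t.upCoeff = 0
      · rw [ht, zero_mul]
        positivity
      have ht1 : t.upCoeff = 1 := by cases t <;> simp_all [LaplacianType.upCoeff]
      have h2 := (D.sum_upKernel_le hsum (η := η) (τ := τ) (fun ρ σ hne hρ hτ =>
        sq_prod_sub_prod_le_of_coface ht h0 h1 hφ hne hρ hτ) T).trans
        (mul_le_mul_left (ENNReal.rpow_neg_half_div_sq_mul_le _ _) _)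
      rw [hr, ← ENNReal.ofReal_sum_of_nonneg fun ρ _ => mul_nonneg (abs_nonneg _) (sq_nonneg _),
        ← ENNReal.ofReal_mul (by positivity)] at h2
      rw [ht1, one_mul]
      exact (ENNReal.ofReal_le_ofReal_iff (by positivity)).1 h2
    have hdown : t.downCoeff * ∑ ρ ∈ T, |D.properDownKernel ρ τ| * (η ρ - η τ) ^ 2 ≤
        ε / 2 * X.wt τ := by
      by_cases ht : t.downCoeff = 0
      · rw [ht, zero_mul]
        positivity
      have ht1 : t.downCoeff = 1 := by cases t <;> simp_all [LaplacianType.downCoeff]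
      have h2 := (D.sum_properDownKernel_le (η := η) (τ := τ) (fun ρ κ _ hκ hτ hρ =>
        sq_prod_sub_prod_le_of_face ht h0 h1 hφ hκ hτ hρ) T).trans
        (mul_le_mul_left (ENNReal.rpow_neg_half_div_sq_mul_le _ _) _)
      rw [hr, ← ENNReal.ofReal_sum_of_nonneg fun ρ _ => mul_nonneg (abs_nonneg _) (sq_nonneg _),
        ← ENNReal.ofReal_mul (by positivity)] at h2
      rw [ht1, one_mul]
      exact (ENNReal.ofReal_le_ofReal_iff (by positivity)).1 h2
    calc ∑ ρ ∈ T, |D.properKernel t ρ τ| * (η ρ - η τ) ^ 2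
        ≤ ∑ ρ ∈ T, (t.upCoeff * (|D.upKernel ρ τ| * (η ρ - η τ) ^ 2) +
            t.downCoeff * (|D.properDownKernel ρ τ| * (η ρ - η τ) ^ 2)) := by
          refine Finset.sum_le_sum fun ρ _ => ?_
          rw [← mul_assoc, ← mul_assoc, ← add_mul]
          refine mul_le_mul_of_nonneg_right ((abs_add_le _ _).trans_eq ?_) (sq_nonneg _)
          rw [abs_mul, abs_mul, abs_of_nonneg t.upCoeff_nonneg, abs_of_nonneg t.downCoeff_nonneg]
      _ ≤ ε / 2 * X.wt τ + ε / 2 * X.wt τ := by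
          rw [Finset.sum_add_distrib, ← Finset.mul_sum, ← Finset.mul_sum]
          exact add_le_add hup hdown
      _ = ε * X.wt τ := by ring

end WeightedComplex

end

theorem mainTheorem2 {V : Type*} [Countable V] (X : WeightedComplex V)
    (hsum : X.LocallySummable) (D : X.Coboundary) (t : LaplacianType)
    (hballs : X.FiniteBalls t) (hX : X.LocallyFinite ∨ X.Balanced) :
    ∃ h : D.MapsFcToL2 t, IsEssentiallySelfAdjoint (D.laplacianC t h) :=
  ⟨D.mapsFcToL2 t hsum hballs.finite_cofaces,
    D.isEssentiallySelfAdjoint_of_cutoff t hsum hballs.finite_cofaces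
      (fun F _ hε => hballs.exists_cutoff hsum D F hε) _⟩
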